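/- Let $m\ge 5$, let $\mathbb S^m\subset\mathbb R^{m+1}$ be the Euclidean unit sphere with its round metric $g$, and let $(N^n,h)$ be a smooth, connected Riemannian manifold without boundary. For a smooth map $\psi:\mathbb S^m\to N$ with tension field $\tau(\psi)=\operatorname{Tr}\nabla d\psi$, the conformal-bienergy is $$E_2^c(\psi)=\frac12\int_{\mathbb S^m}\Big(|\tau(\psi)|^2+\tfrac23\operatorname{Scal}\,|d\psi|^2-2\operatorname{Tr}\langle d\psi(\operatorname{Ric}(\cdot)),d\psi(\cdot)\rangle\Big)\,v_g ,$$ where $\operatorname{Ric}$, $\operatorname{Scal}$ and $v_g$ are the Ricci tensor, the scalar curvature and the volume element of $(\mathbb S^m,g)$. **Theorem.** Let $\varphi:\mathbb S^m\to N$ be a harmonic map, i.e. a smooth map with $\tau(\varphi)=0$. Then $$\inf\{E_2^c(\psi)\;:\;\psi:\mathbb S^m\to N\text{ smooth and homotopic to }\varphi\}=0 .$$ -/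

import Mathlib

open Bundle MeasureTheory
open scoped Manifold ContDiff Matrix

noncomputable section

/-- A smooth Riemannian metric on a smooth `m`-manifold `M` (without boundary). -/
abbrev SmoothMetric (m : ℕ) (M : Type*) [TopologicalSpace M]
    [ChartedSpace (EuclideanSpace ℝ (Fin m)) M] [IsManifold (𝓡 m) ∞ M] :=
  ContMDiffRiemannianMetric (𝓡 m) ∞ (EuclideanSpace ℝ (Fin m))
    (fun x : M => TangentSpace (𝓡 m) x)

/-- The `i`-th partial derivative of `f : ℝᵐ → ℝ` at `y`. -/
def partialDeriv {m : ℕ} (i : Fin m) (f : EuclideanSpace ℝ (Fin m) → ℝ)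
    (y : EuclideanSpace ℝ (Fin m)) : ℝ :=
  fderiv ℝ f y (EuclideanSpace.single i 1)

section Metric

variable {m : ℕ} {M : Type*} [TopologicalSpace M]
  [ChartedSpace (EuclideanSpace ℝ (Fin m)) M] [IsManifold (𝓡 m) ∞ M]

/-- The coordinate vector `∂ᵢ` of the preferred chart around `c`, at the point with
coordinates `y`. -/
def coordVec (c : M) (y : EuclideanSpace ℝ (Fin m)) (i : Fin m) :
    TangentSpace (𝓡 m) ((extChartAt (𝓡 m) c).symm y) :=
  mfderiv 𝓘(ℝ, EuclideanSpace ℝ (Fin m)) (𝓡 m) (extChartAt (𝓡 m) c).symm y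
    (EuclideanSpace.single i (1 : ℝ) : EuclideanSpace ℝ (Fin m))

/-- The coefficients `gᵢⱼ = g(∂ᵢ, ∂ⱼ)` of a metric in the preferred chart around `c`, at the
point with coordinates `y`. The matrix inverse of `metricCoeff g c y` has entries `gⁱʲ`. -/
def metricCoeff (g : SmoothMetric m M) (c : M) (y : EuclideanSpace ℝ (Fin m)) :
    Matrix (Fin m) (Fin m) ℝ :=
  Matrix.of fun i j =>
    g.inner ((extChartAt (𝓡 m) c).symm y) (coordVec c y i) (coordVec c y j)

/-- The Christoffel symbols `Γᵏᵢⱼ = ½ gᵏˡ (∂ᵢ gⱼₗ + ∂ⱼ gᵢₗ - ∂ₗ gᵢⱼ)` of the Levi-Civita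
connection in the preferred chart around `c`, at the point with coordinates `y`. -/
def christoffel (g : SmoothMetric m M) (c : M) (k i j : Fin m)
    (y : EuclideanSpace ℝ (Fin m)) : ℝ :=
  (1 / 2) * ∑ l, (metricCoeff g c y)⁻¹ k l *
    (partialDeriv i (fun z => metricCoeff g c z j l) y
      + partialDeriv j (fun z => metricCoeff g c z i l) y
      - partialDeriv l (fun z => metricCoeff g c z i j) y)

/-- The components `Rˡ` of `R(∂ᵢ, ∂ⱼ)∂ₖ = Rˡ ∂ₗ`, where
`R(X, Y)Z = [∇_X, ∇_Y]Z - ∇_[X,Y] Z`, in the preferred chart around `c`. -/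
def curvatureCoeff (g : SmoothMetric m M) (c : M) (l i j k : Fin m)
    (y : EuclideanSpace ℝ (Fin m)) : ℝ :=
  partialDeriv i (christoffel g c l j k) y - partialDeriv j (christoffel g c l i k) y
    + ∑ s, (christoffel g c l i s y * christoffel g c s j k y
      - christoffel g c l j s y * christoffel g c s i k y)

/-- The components `Ricⱼₖ` of the Ricci tensor `Ric(X, Y) = Tr (Z ↦ R(Z, X)Y)` in the preferred
chart around `c`. -/
def ricciCoeff (g : SmoothMetric m M) (c : M) (j k : Fin m)
    (y : EuclideanSpace ℝ (Fin m)) : ℝ :=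
  ∑ i, curvatureCoeff g c i i j k y

/-- The scalar curvature `Scal = gʲᵏ Ricⱼₖ` at the point `p`. -/
def scalarCurvature (g : SmoothMetric m M) (p : M) : ℝ :=
  ∑ j, ∑ k, (metricCoeff g p (extChartAt (𝓡 m) p p))⁻¹ j k
    * ricciCoeff g p j k (extChartAt (𝓡 m) p p)

end Metric

section Maps

variable {m n : ℕ}
  {M : Type*} [TopologicalSpace M] [ChartedSpace (EuclideanSpace ℝ (Fin m)) M]
  [IsManifold (𝓡 m) ∞ M]
  {N : Type*} [TopologicalSpace N] [ChartedSpace (EuclideanSpace ℝ (Fin n)) N]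
  [IsManifold (𝓡 n) ∞ N]

/-- The component `φᵃ` of `φ` read in the preferred charts around `p` and `φ p`. -/
def mapCoord (φ : M → N) (p : M) (a : Fin n) (y : EuclideanSpace ℝ (Fin m)) : ℝ :=
  writtenInExtChartAt (𝓡 m) (𝓡 n) p φ y a

/-- The components, with respect to the coordinate frame at `p` of the preferred chart around `p`,
of the pulled back tensor `φ*h`, that is `h(dφ ∂ᵢ, dφ ∂ⱼ) = hₐᵦ ∂ᵢφᵃ ∂ⱼφᵇ`. -/
def pullbackCoeff (h : SmoothMetric n N) (φ : M → N) (p : M) (i j : Fin m) : ℝ :=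
  ∑ a, ∑ b, metricCoeff h (φ p) (extChartAt (𝓡 n) (φ p) (φ p)) a b
    * partialDeriv i (mapCoord φ p a) (extChartAt (𝓡 m) p p)
    * partialDeriv j (mapCoord φ p b) (extChartAt (𝓡 m) p p)

/-- `|dφ|² = gⁱʲ h(dφ ∂ᵢ, dφ ∂ⱼ)` at `p`. -/
def differentialNormSq (g : SmoothMetric m M) (h : SmoothMetric n N) (φ : M → N) (p : M) : ℝ :=
  ∑ i, ∑ j, (metricCoeff g p (extChartAt (𝓡 m) p p))⁻¹ i j * pullbackCoeff h φ p i j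

/-- The components of the tension field `τ(φ) = Tr ∇dφ` at `p`, with respect to the coordinate
frame at `φ p` of the preferred chart around `φ p`:
`τᶜ = gⁱʲ (∂ᵢ∂ⱼφᶜ - Γᵏᵢⱼ ∂ₖφᶜ + Γᶜₐᵦ(φ) ∂ᵢφᵃ ∂ⱼφᵇ)`. -/
def tensionField (g : SmoothMetric m M) (h : SmoothMetric n N) (φ : M → N) (p : M)
    (c : Fin n) : ℝ :=
  ∑ i, ∑ j, (metricCoeff g p (extChartAt (𝓡 m) p p))⁻¹ i j *
    (partialDeriv i (partialDeriv j (mapCoord φ p c)) (extChartAt (𝓡 m) p p)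
      - ∑ k, christoffel g p k i j (extChartAt (𝓡 m) p p)
          * partialDeriv k (mapCoord φ p c) (extChartAt (𝓡 m) p p)
      + ∑ a, ∑ b, christoffel h (φ p) c a b (extChartAt (𝓡 n) (φ p) (φ p))
          * partialDeriv i (mapCoord φ p a) (extChartAt (𝓡 m) p p)
          * partialDeriv j (mapCoord φ p b) (extChartAt (𝓡 m) p p))

/-- `|τ(φ)|²` at `p`. -/
def tensionNormSq (g : SmoothMetric m M) (h : SmoothMetric n N) (φ : M → N) (p : M) : ℝ :=
  ∑ a, ∑ b, metricCoeff h (φ p) (extChartAt (𝓡 n) (φ p) (φ p)) a b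
    * tensionField g h φ p a * tensionField g h φ p b

/-- `Tr ⟨dφ(Ric(·)), dφ(·)⟩ = gⁱᵃ gʲᵇ Ricₐᵦ h(dφ ∂ᵢ, dφ ∂ⱼ)` at `p`. -/
def ricciTrace (g : SmoothMetric m M) (h : SmoothMetric n N) (φ : M → N) (p : M) : ℝ :=
  ∑ i, ∑ j, ∑ a, ∑ b, (metricCoeff g p (extChartAt (𝓡 m) p p))⁻¹ i a
    * (metricCoeff g p (extChartAt (𝓡 m) p p))⁻¹ j b
    * ricciCoeff g p a b (extChartAt (𝓡 m) p p) * pullbackCoeff h φ p i j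

/-- A smooth map is harmonic if its tension field vanishes. -/
def IsHarmonicMap (g : SmoothMetric m M) (h : SmoothMetric n N) (φ : C^∞⟮𝓡 m, M; 𝓡 n, N⟯) : Prop :=
  ∀ p c, tensionField g h φ p c = 0

/-- The conformal-bienergy
`E₂ᶜ(φ) = ½ ∫ |τ(φ)|² + (2/3) Scal |dφ|² - 2 Tr ⟨dφ(Ric(·)), dφ(·)⟩`,
where the integral is taken over `M` with respect to the measure `vol`, to be instantiated with
the Riemannian volume measure of `(M, g)`. -/
def conformalBienergy [MeasurableSpace M] (g : SmoothMetric m M) (vol : Measure M)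
    (h : SmoothMetric n N) (φ : C^∞⟮𝓡 m, M; 𝓡 n, N⟯) : ℝ :=
  (1 / 2) * ∫ p, (tensionNormSq g h φ p + (2 / 3) * scalarCurvature g p * differentialNormSq g h φ p
    - 2 * ricciTrace g h φ p) ∂vol

end Maps

section Sphere

/-- The Euclidean unit sphere `𝕊ᵐ` in `ℝᵐ⁺¹`. -/
abbrev UnitSphere (m : ℕ) : Type := Metric.sphere (0 : EuclideanSpace ℝ (Fin (m + 1))) 1

/-- The differential at `p` of the inclusion of the sphere in Euclidean space. -/
def sphereInclDeriv (m : ℕ) (p : UnitSphere m) :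
    TangentSpace (𝓡 m) p →L[ℝ] EuclideanSpace ℝ (Fin (m + 1)) :=
  mfderiv (𝓡 m) 𝓘(ℝ, EuclideanSpace ℝ (Fin (m + 1)))
    ((↑) : UnitSphere m → EuclideanSpace ℝ (Fin (m + 1))) p

theorem sphereInclDeriv_injective (m : ℕ) (p : UnitSphere m) :
    Function.Injective (sphereInclDeriv m p) := by
  have : Fact (Module.finrank ℝ (EuclideanSpace ℝ (Fin (m + 1))) = m + 1) :=
    ⟨finrank_euclideanSpace_fin⟩
  exact injective_mvfderiv_subtypeVal_sphere p

theorem sphereInner_isVonNBounded (m : ℕ) (p : UnitSphere m) :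
    Bornology.IsVonNBounded ℝ {v : TangentSpace (𝓡 m) p |
      inner ℝ (sphereInclDeriv m p v) (sphereInclDeriv m p v) < 1} := by
  let A : EuclideanSpace ℝ (Fin m) →L[ℝ] EuclideanSpace ℝ (Fin (m + 1)) := sphereInclDeriv m p
  change Bornology.IsVonNBounded ℝ {v : EuclideanSpace ℝ (Fin m) | inner ℝ (A v) (A v) < 1}
  obtain ⟨K, hK, hA⟩ := A.toLinearMap.exists_antilipschitzWith
    (LinearMap.ker_eq_bot.2 (sphereInclDeriv_injective m p))
  rw [NormedSpace.isVonNBounded_iff' ℝ]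
  refine ⟨K, fun v hv => ?_⟩
  rw [Set.mem_ofPred_eq, real_inner_self_eq_norm_sq] at hv
  have h1 : ‖A v‖ ≤ 1 := by nlinarith [norm_nonneg (A v)]
  have h2 := hA.le_mul_dist v 0
  simp only [dist_zero_right, map_zero] at h2
  calc ‖v‖ ≤ K * ‖A v‖ := h2
    _ ≤ K * 1 := by gcongr
    _ = K := mul_one _

set_option synthInstance.maxHeartbeats 400000 in
theorem contDiff_pullback_inner (E F : Type*) [NormedAddCommGroup E] [NormedSpace ℝ E]
    [NormedAddCommGroup F] [InnerProductSpace ℝ F] :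
    ContDiff ℝ ∞ fun A : E →L[ℝ] F =>
      ((ContinuousLinearMap.compL ℝ E F ℝ).flip A).comp
        (((innerSL ℝ : F →L[ℝ] F →L[ℝ] ℝ)).comp A) :=
  ((ContinuousLinearMap.compL ℝ E F ℝ).flip.contDiff).clm_comp (contDiff_const.clm_comp contDiff_id)

/-- The round metric on the unit sphere, induced by the Euclidean inner product. -/
def sphereMetric (m : ℕ) : SmoothMetric m (UnitSphere m) where
  inner p := ((sphereInclDeriv m p).precomp ℝ).comp ((innerSL ℝ).comp (sphereInclDeriv m p))
  symm p v w := real_inner_comm (F := EuclideanSpace ℝ (Fin (m + 1))) (sphereInclDeriv m p w)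
    (sphereInclDeriv m p v)
  pos p v hv := real_inner_self_pos.2 fun h0 =>
    hv (sphereInclDeriv_injective m p (h0.trans (map_zero _).symm))
  isVonNBounded p := sphereInner_isVonNBounded m p
  contMDiff p := by
    have : Fact (Module.finrank ℝ (EuclideanSpace ℝ (Fin (m + 1))) = m + 1) :=
      ⟨finrank_euclideanSpace_fin⟩
    rw [contMDiffAt_hom_bundle]
    refine ⟨contMDiffAt_id, ?_⟩
    have hA := ContMDiffAt.mfderiv_const (m := ∞) (n := ∞) (x₀ := p)
      (contMDiff_coe_sphere (n := m) (E := EuclideanSpace ℝ (Fin (m + 1)))).contMDiffAt (by simp)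
    refine (((contDiff_pullback_inner (EuclideanSpace ℝ (Fin m))
      (EuclideanSpace ℝ (Fin (m + 1)))).contMDiff.contMDiffAt).comp p hA).congr_of_eventuallyEq ?_
    filter_upwards [(trivializationAt (EuclideanSpace ℝ (Fin m))
      (TangentSpace (𝓡 m) : UnitSphere m → Type) p).open_baseSet.mem_nhds
      (FiberBundle.mem_baseSet_trivializationAt' p)] with x hx
    ext v w
    erw [inCoordinates_apply_eq₂ hx hx (by trivial)]
    have key : ∀ u : EuclideanSpace ℝ (Fin m),
        inTangentCoordinates (𝓡 m) 𝓘(ℝ, EuclideanSpace ℝ (Fin (m + 1))) id Subtype.val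
          (mfderiv (𝓡 m) 𝓘(ℝ, EuclideanSpace ℝ (Fin (m + 1)))
            ((↑) : UnitSphere m → EuclideanSpace ℝ (Fin (m + 1)))) p x u
        = sphereInclDeriv m x ((trivializationAt (EuclideanSpace ℝ (Fin m))
            (TangentSpace (𝓡 m)) p).symm x u) := by
      intro u
      simp [inTangentCoordinates, ContinuousLinearMap.inCoordinates, sphereInclDeriv]
      rw [← Trivialization.symmL_apply (R := ℝ) _ hx]
      rfl
    have hR : ∀ A : EuclideanSpace ℝ (Fin m) →L[ℝ] EuclideanSpace ℝ (Fin (m + 1)),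
        ((ContinuousLinearMap.compL ℝ (EuclideanSpace ℝ (Fin m)) (EuclideanSpace ℝ (Fin (m + 1)))
          ℝ).flip A ∘SL innerSL ℝ ∘SL A) v w = inner ℝ (A v) (A w) := fun A => rfl
    rw [Function.comp_apply, hR, key, key]
    simp

/-- The Riemannian volume measure of the round unit sphere, that is, the surface measure of the
unit sphere in Euclidean space. -/
def sphereVolume (m : ℕ) : Measure (UnitSphere m) :=
  (volume : Measure (EuclideanSpace ℝ (Fin (m + 1)))).toSphere

end Sphere

end

/-! On the round sphere `Scal = m(m-1)` and `Ric = (m-1)g`, so the energy density is |τ(ψ)|² +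
(2/3)(m-1)(m-3)|dψ|² (`conformalBienergy_sphereMetric`). For m ≥ 5 this is nonnegative, which gives
the lower bound.

For the infimum, precompose φ with the conformal dilations σ_a, where a = s·e₀ and s tends to 1.
Letting a shrink to 0 is a homotopy from φ ∘ σ_a to φ. Write D = 1 + 2⟨a,x⟩ + |a|² = |x + a|². The
conformal factor of σ_a is λ = (1-|a|²)/D, hence |d(φ∘σ_a)|² = λ² |dφ|²∘σ_a
(`differentialNormSq_comp`). Harmonicity removes the first term of τ(φ∘σ_a) = λ² τ(φ)∘σ_a +
dφ(τ(σ_a)) (`tensionField_comp`), and |τ(σ_a)|² ≤ (2m-4)² (1-|a|²)²/D³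
(`sum_sq_laplacian_dilationTransition_le`). Since |dφ|² is bounded by compactness
(`exists_differentialNormSq_le`), the whole density is at most a constant times (1-s²)²/D³
(`energyDensity_comp_dilation_le`).

This majorant tends to 0 off the pole -e₀ and is dominated, uniformly in s, by 4/(1-x₀²)². Near a
pole the latter grows like the distance to the power -4, which is integrable exactly when m ≥ 5
(`integrable_inv_one_sub_coord_sq`). Dominated convergence (`tendsto_integral_dilationDensity`)
finishes the proof.

All tensors are evaluated at the centre of a stereographic chart, where the coordinates vanish, the
metric is the identity and the Christoffel symbols are zero. The geometry thus reduces to first and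
second derivatives at the origin. -/

noncomputable section

/-! ### Stereographic charts of the sphere and the round metric in them. -/

section SphereCharts

variable {m : ℕ}

/-- The orthonormal coordinates of the hyperplane orthogonal to `p` that are used by the preferred
chart of the sphere around `p`. -/
def tangentCoordEquiv (p : UnitSphere m) :
    (Submodule.span ℝ {((-p : UnitSphere m) : EuclideanSpace ℝ (Fin (m + 1)))})ᗮ ≃ₗᵢ[ℝ]
      EuclideanSpace ℝ (Fin m) :=
  have := Fact.mk (@finrank_euclideanSpace_fin ℝ _ (m + 1))
  (OrthonormalBasis.fromOrthogonalSpanSingleton (𝕜 := ℝ) m (ne_zero_of_mem_unit_sphere (-p))).repr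

/-- The isometric parametrization of the hyperplane orthogonal to `p` that is used by the preferred
chart of the sphere around `p`. -/
def tangentFrame (p : UnitSphere m) :
    EuclideanSpace ℝ (Fin m) →ₗᵢ[ℝ] EuclideanSpace ℝ (Fin (m + 1)) :=
  (Submodule.subtypeₗᵢ _).comp (tangentCoordEquiv p).symm.toLinearIsometry

/-- The inverse stereographic projection from `-p`, as a map into the ambient space. -/
def stereoParam (p : UnitSphere m) (y : EuclideanSpace ℝ (Fin m)) :
    EuclideanSpace ℝ (Fin (m + 1)) :=
  (‖y‖ ^ 2 + 4)⁻¹ • ((4 : ℝ) • tangentFrame p y + (4 - ‖y‖ ^ 2) • (p : EuclideanSpace ℝ _))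

theorem inner_self_sphere (p : UnitSphere m) :
    inner ℝ (p : EuclideanSpace ℝ (Fin (m + 1))) p = 1 := by
  rw [real_inner_self_eq_norm_sq, norm_eq_of_mem_sphere]; norm_num

theorem inner_sphere_tangentFrame (p : UnitSphere m) (y : EuclideanSpace ℝ (Fin m)) :
    inner ℝ (p : EuclideanSpace ℝ (Fin (m + 1))) (tangentFrame p y) = 0 := by
  have h := Submodule.mem_orthogonal_singleton_iff_inner_right.1 ((tangentCoordEquiv p).symm y).2
  have h' : inner ℝ (-(p : EuclideanSpace ℝ (Fin (m + 1)))) (tangentFrame p y) = 0 := h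
  rwa [inner_neg_left, neg_eq_zero] at h'

theorem inner_tangentFrame_sphere (p : UnitSphere m) (y : EuclideanSpace ℝ (Fin m)) :
    inner ℝ (tangentFrame p y) (p : EuclideanSpace ℝ (Fin (m + 1))) = 0 :=
  (real_inner_comm _ _).trans (inner_sphere_tangentFrame p y)

theorem inner_tangentFrame (p : UnitSphere m) (y z : EuclideanSpace ℝ (Fin m)) :
    inner ℝ (tangentFrame p y) (tangentFrame p z) = inner ℝ y z :=
  (tangentFrame p).inner_map_map y z

/-- The preferred chart at `p` projects from `-p`, so `p` itself sits at the origin; the sign of the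
pole is absorbed into `4 - ‖y‖ ^ 2`. -/
theorem extChartAt_sphere_symm_apply (p : UnitSphere m) (y : EuclideanSpace ℝ (Fin m)) :
    (((extChartAt (𝓡 m) p).symm y : UnitSphere m) : EuclideanSpace ℝ (Fin (m + 1)))
      = stereoParam p y := by
  have := Fact.mk (@finrank_euclideanSpace_fin ℝ _ (m + 1))
  have h := stereographic'_symm_apply (n := m) (-p) y
  have hn : ‖(((tangentCoordEquiv p).symm y :
      (Submodule.span ℝ {((-p : UnitSphere m) : EuclideanSpace ℝ (Fin (m + 1)))})ᗮ) :
      EuclideanSpace ℝ (Fin (m + 1)))‖ = ‖y‖ := by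
    exact (tangentCoordEquiv p).symm.norm_map y
  refine h.trans ?_
  change (‖(((tangentCoordEquiv p).symm y : _) : EuclideanSpace ℝ (Fin (m + 1)))‖ ^ 2 + 4)⁻¹ •
      (4 : ℝ) • tangentFrame p y +
    (‖(((tangentCoordEquiv p).symm y : _) : EuclideanSpace ℝ (Fin (m + 1)))‖ ^ 2 + 4)⁻¹ •
    (‖(((tangentCoordEquiv p).symm y : _) : EuclideanSpace ℝ (Fin (m + 1)))‖ ^ 2 - 4) •
      (-(p : EuclideanSpace ℝ (Fin (m + 1)))) = _
  rw [hn, stereoParam]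
  module

theorem coord_tangentCoordEquiv (p : UnitSphere m)
    (z : (Submodule.span ℝ {((-p : UnitSphere m) : EuclideanSpace ℝ (Fin (m + 1)))})ᗮ)
    (k : Fin m) :
    tangentCoordEquiv p z k
      = inner ℝ (tangentFrame p (EuclideanSpace.single k 1)) (z : EuclideanSpace ℝ (Fin (m + 1)))
    := by
  have h : inner ℝ ((tangentCoordEquiv p).symm (EuclideanSpace.single k 1)) z
      = inner ℝ (EuclideanSpace.single k (1 : ℝ)) (tangentCoordEquiv p z) := by
    conv_lhs => rw [← (tangentCoordEquiv p).symm_apply_apply z]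
    exact LinearIsometryEquiv.inner_map_map _ _ _
  rw [EuclideanSpace.inner_single_left] at h
  simp only [map_one, one_mul] at h
  rw [← h]
  rfl

theorem inner_tangentFrame_orthogonalProjection (p : UnitSphere m)
    (y : EuclideanSpace ℝ (Fin m)) (x : EuclideanSpace ℝ (Fin (m + 1))) :
    inner ℝ (tangentFrame p y) ((Submodule.orthogonalProjectionOnto (Submodule.span ℝ
      {((-p : UnitSphere m) : EuclideanSpace ℝ (Fin (m + 1)))})ᗮ x : _) :
        EuclideanSpace ℝ (Fin (m + 1))) = inner ℝ (tangentFrame p y) x := by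
  change inner ℝ (((tangentCoordEquiv p).symm y : _) : EuclideanSpace ℝ (Fin (m + 1))) _ = _
  rw [← Submodule.coe_inner, Submodule.inner_orthogonalProjectionOnto_eq_of_mem_left]
  rfl

theorem extChartAt_sphere_apply (p x : UnitSphere m) (k : Fin m) :
    (extChartAt (𝓡 m) p x : EuclideanSpace ℝ (Fin m)) k
      = 2 / (1 + inner ℝ (p : EuclideanSpace ℝ (Fin (m + 1))) x)
        * inner ℝ (tangentFrame p (EuclideanSpace.single k 1)) (x : EuclideanSpace ℝ _) := by
  have h : (extChartAt (𝓡 m) p x : EuclideanSpace ℝ (Fin m))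
      = tangentCoordEquiv p (stereoToFun ((-p : UnitSphere m) : EuclideanSpace ℝ (Fin (m + 1)))
        (x : EuclideanSpace ℝ (Fin (m + 1)))) := rfl
  rw [h, coord_tangentCoordEquiv, stereoToFun_apply, Submodule.coe_smul, inner_smul_right,
    inner_tangentFrame_orthogonalProjection]
  simp

/-- Parseval: the frame together with `p` is an orthonormal basis of the ambient space. This
eliminates the arbitrary frame from every trace taken later. -/
theorem sum_inner_tangentFrame (p : UnitSphere m) (x y : EuclideanSpace ℝ (Fin (m + 1))) :
    ∑ k, inner ℝ (tangentFrame p (EuclideanSpace.single k 1)) x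
        * inner ℝ (tangentFrame p (EuclideanSpace.single k 1)) y
      = inner ℝ x y - inner ℝ (p : EuclideanSpace ℝ (Fin (m + 1))) x
        * inner ℝ (p : EuclideanSpace ℝ (Fin (m + 1))) y := by
  have key : ∀ x : EuclideanSpace ℝ (Fin (m + 1)), ∀ k,
      inner ℝ (tangentFrame p (EuclideanSpace.single k 1)) x
        = tangentCoordEquiv p (Submodule.orthogonalProjectionOnto (Submodule.span ℝ
      {((-p : UnitSphere m) : EuclideanSpace ℝ (Fin (m + 1)))})ᗮ x) k := by
    intro x k
    rw [coord_tangentCoordEquiv, inner_tangentFrame_orthogonalProjection]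
  have h2 : ∀ u v : EuclideanSpace ℝ (Fin m), ∑ k, u k * v k = inner ℝ u v := by
    intro u v
    rw [PiLp.inner_apply]
    exact Finset.sum_congr rfl fun k _ => by simp [mul_comm]
  have h3 : ∀ x : EuclideanSpace ℝ (Fin (m + 1)), (Submodule.span ℝ
      {((-p : UnitSphere m) : EuclideanSpace ℝ (Fin (m + 1)))}).starProjection x
        = inner ℝ (p : EuclideanSpace ℝ (Fin (m + 1))) x • (p : EuclideanSpace ℝ (Fin (m + 1))) := by
    intro x
    rw [Submodule.starProjection_unit_singleton ℝ (norm_eq_of_mem_sphere (-p))]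
    simp
  simp_rw [key, h2, LinearIsometryEquiv.inner_map_map]
  have h4 := (Submodule.span ℝ {((-p : UnitSphere m) : EuclideanSpace ℝ (Fin (m + 1)))}
    ).starProjection_add_starProjection_orthogonal y
  rw [h3, Submodule.starProjection_apply] at h4
  have h5 := congrArg (inner ℝ x ·) h4
  simp only [inner_add_right, inner_smul_right] at h5
  rw [Submodule.inner_orthogonalProjectionOnto_eq_of_mem_right, ← h5, real_inner_comm x]
  have h6 : ∀ a b c : ℝ, a = b * c + a - c * b := fun a b c => by ring
  exact h6 _ _ _

theorem stereoParam_zero (p : UnitSphere m) :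
    stereoParam p 0 = (p : EuclideanSpace ℝ (Fin (m + 1))) := by
  simp [stereoParam]

theorem extChartAt_sphere_self (p : UnitSphere m) :
    (extChartAt (𝓡 m) p p : EuclideanSpace ℝ (Fin m)) = 0 := by
  ext k
  rw [extChartAt_sphere_apply, inner_tangentFrame_sphere, mul_zero]
  rfl

theorem extChartAt_sphere_target (p : UnitSphere m) :
    (extChartAt (𝓡 m) p).target = Set.univ := by
  have := Fact.mk (@finrank_euclideanSpace_fin ℝ _ (m + 1))
  rw [extChartAt_target]
  have : (chartAt (EuclideanSpace ℝ (Fin m)) p).target = Set.univ := stereographic'_target (-p)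
  simp [this]

theorem hasFDerivAt_stereoParam (p : UnitSphere m) (y : EuclideanSpace ℝ (Fin m)) :
    HasFDerivAt (stereoParam p)
      ((‖y‖ ^ 2 + 4)⁻¹ • ((4 : ℝ) • (tangentFrame p).toContinuousLinearMap
          - ((2 : ℝ) • innerSL ℝ y).smulRight (p : EuclideanSpace ℝ (Fin (m + 1))))
        - (((‖y‖ ^ 2 + 4)⁻¹ ^ 2 * 2) • innerSL ℝ y).smulRight
          ((4 : ℝ) • tangentFrame p y + (4 - ‖y‖ ^ 2) • (p : EuclideanSpace ℝ _))) y := by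
  have h0 := (hasStrictFDerivAt_norm_sq y).hasFDerivAt
  have hr : ‖y‖ ^ 2 + 4 ≠ 0 := by positivity
  have h1 := (hasFDerivAt_inv hr).comp y (h0.add_const 4)
  have h2 := (((tangentFrame p).toContinuousLinearMap.hasFDerivAt (x := y)).const_smul (4 : ℝ)).add
    ((h0.const_sub 4).smul_const (p : EuclideanSpace ℝ (Fin (m + 1))))
  refine (h1.smul h2).congr_fderiv ?_
  ext1 v
  simp
  module

/-- Conformality of stereographic projection. The cross terms vanish because the frame is orthogonal
to `p`. -/
theorem inner_fderiv_stereoParam (p : UnitSphere m) (y v w : EuclideanSpace ℝ (Fin m)) :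
    inner ℝ (fderiv ℝ (stereoParam p) y v) (fderiv ℝ (stereoParam p) y w)
      = 16 / (‖y‖ ^ 2 + 4) ^ 2 * inner ℝ v w := by
  rw [(hasFDerivAt_stereoParam p y).fderiv]
  have h1 := inner_sphere_tangentFrame p
  have h2 := inner_tangentFrame_sphere p
  have h3 := real_inner_self_eq_norm_sq y
  have hr : ‖y‖ ^ 2 + 4 ≠ 0 := by positivity
  simp [inner_add_left, inner_add_right, inner_sub_left, inner_sub_right, inner_smul_left,
    inner_smul_right, h1, h2]
  rw [real_inner_comm y v]
  field_simp
  ring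

theorem contMDiff_extChartAt_sphere_symm (p : UnitSphere m) :
    ContMDiff 𝓘(ℝ, EuclideanSpace ℝ (Fin m)) (𝓡 m) ∞ (extChartAt (𝓡 m) p).symm := by
  rw [← contMDiffOn_univ, ← extChartAt_sphere_target p]
  exact contMDiffOn_extChartAt_symm p

theorem sphereInclDeriv_coordVec (p : UnitSphere m) (y : EuclideanSpace ℝ (Fin m)) (i : Fin m) :
    sphereInclDeriv m ((extChartAt (𝓡 m) p).symm y) (coordVec p y i)
      = fderiv ℝ (stereoParam p) y (EuclideanSpace.single i 1) := by
  have := Fact.mk (@finrank_euclideanSpace_fin ℝ _ (m + 1))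
  have h1 : MDifferentiableAt (𝓡 m) 𝓘(ℝ, EuclideanSpace ℝ (Fin (m + 1)))
      ((↑) : UnitSphere m → EuclideanSpace ℝ (Fin (m + 1))) ((extChartAt (𝓡 m) p).symm y) :=
    (contMDiff_coe_sphere (m := ∞)).mdifferentiableAt (by simp)
  have h2 := (contMDiff_extChartAt_sphere_symm p).mdifferentiableAt (x := y) (by simp)
  have h3 := mfderiv_comp y h1 h2
  have h4 : ((↑) : UnitSphere m → EuclideanSpace ℝ (Fin (m + 1))) ∘ (extChartAt (𝓡 m) p).symm
      = stereoParam p := funext (extChartAt_sphere_symm_apply p)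
  rw [h4, mfderiv_eq_fderiv] at h3
  rw [h3]
  rfl

theorem metricCoeff_sphereMetric (p : UnitSphere m) (y : EuclideanSpace ℝ (Fin m)) :
    metricCoeff (sphereMetric m) p y = (16 / (‖y‖ ^ 2 + 4) ^ 2) • (1 : Matrix (Fin m) (Fin m) ℝ) := by
  ext i j
  have h : metricCoeff (sphereMetric m) p y i j = inner ℝ
      (sphereInclDeriv m ((extChartAt (𝓡 m) p).symm y) (coordVec p y i))
      (sphereInclDeriv m ((extChartAt (𝓡 m) p).symm y) (coordVec p y j)) := rfl
  rw [h, sphereInclDeriv_coordVec, sphereInclDeriv_coordVec, inner_fderiv_stereoParam,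
    EuclideanSpace.inner_single_left]
  simp [Matrix.one_apply]

end SphereCharts

/-! ### Curvature of the round sphere and the reduced form of the energy. -/

section SphereCurvature

variable {m : ℕ}

theorem inv_metricCoeff_sphereMetric (p : UnitSphere m) (y : EuclideanSpace ℝ (Fin m)) :
    (metricCoeff (sphereMetric m) p y)⁻¹
      = ((‖y‖ ^ 2 + 4) ^ 2 / 16) • (1 : Matrix (Fin m) (Fin m) ℝ) := by
  rw [metricCoeff_sphereMetric]
  refine Matrix.inv_eq_left_inv ?_
  have hr : ‖y‖ ^ 2 + 4 ≠ 0 := by positivity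
  rw [Matrix.smul_mul, Matrix.mul_smul, smul_smul, Matrix.one_mul]
  have : (‖y‖ ^ 2 + 4) ^ 2 / 16 * (16 / (‖y‖ ^ 2 + 4) ^ 2) = 1 := by field_simp
  rw [this, one_smul]

theorem inv_metricCoeff_sphereMetric_self (p : UnitSphere m) :
    (metricCoeff (sphereMetric m) p (extChartAt (𝓡 m) p p))⁻¹ = 1 := by
  rw [inv_metricCoeff_sphereMetric, extChartAt_sphere_self]
  norm_num

theorem partialDeriv_metricCoeff_sphereMetric (p : UnitSphere m) (y : EuclideanSpace ℝ (Fin m))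
    (i j k : Fin m) :
    partialDeriv i (fun z => metricCoeff (sphereMetric m) p z j k) y
      = -64 * y i / (‖y‖ ^ 2 + 4) ^ 3 * (1 : Matrix (Fin m) (Fin m) ℝ) j k := by
  have hr : ‖y‖ ^ 2 + 4 ≠ 0 := by positivity
  have h0 := (hasStrictFDerivAt_norm_sq y).hasFDerivAt
  have h1 := ((((hasFDerivAt_inv hr).comp y (h0.add_const 4)).pow 2).const_mul
    16).mul_const ((1 : Matrix (Fin m) (Fin m) ℝ) j k)
  have h2 : (fun z => metricCoeff (sphereMetric m) p z j k) =
      fun z => 16 * ((‖z‖ ^ 2 + 4)⁻¹) ^ 2 * (1 : Matrix (Fin m) (Fin m) ℝ) j k := by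
    funext z
    rw [metricCoeff_sphereMetric]
    simp [div_eq_mul_inv]
  rw [partialDeriv, h2]
  refine (congrArg (fun A : EuclideanSpace ℝ (Fin m) →L[ℝ] ℝ => A (EuclideanSpace.single i 1))
    h1.fderiv).trans ?_
  simp [EuclideanSpace.inner_single_right]
  field_simp
  ring

/-- For a metric `e^{2u}δ` the symbols are `∂ᵢu δⱼₖ + ∂ⱼu δᵢₖ - ∂ₖu δᵢⱼ`; here `u = log (4 / (‖y‖² +
4))`. -/
theorem christoffel_sphereMetric (p : UnitSphere m) (k i j : Fin m)
    (y : EuclideanSpace ℝ (Fin m)) :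
    christoffel (sphereMetric m) p k i j y
      = -2 / (‖y‖ ^ 2 + 4) * (y i * (1 : Matrix (Fin m) (Fin m) ℝ) j k
        + y j * (1 : Matrix (Fin m) (Fin m) ℝ) i k
        - y k * (1 : Matrix (Fin m) (Fin m) ℝ) i j) := by
  have hr : ‖y‖ ^ 2 + 4 ≠ 0 := by positivity
  simp only [christoffel, inv_metricCoeff_sphereMetric, partialDeriv_metricCoeff_sphereMetric]
  rw [Finset.sum_eq_single k]
  · simp only [Matrix.smul_apply, Matrix.one_apply_eq, smul_eq_mul]
    field_simp
    ring
  · intro l _ hl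
    simp [Matrix.one_apply, hl.symm]
  · simp

/-- Since `ℓ 0 = 0`, only the value `-2 / 4` of the prefactor contributes. -/
theorem partialDeriv_div_normSq_add_four (ℓ : EuclideanSpace ℝ (Fin m) →L[ℝ] ℝ) (i : Fin m) :
    partialDeriv i (fun y => -2 / (‖y‖ ^ 2 + 4) * ℓ y) 0
      = -(1 / 2) * ℓ (EuclideanSpace.single i 1) := by
  have h0 := (hasStrictFDerivAt_norm_sq (0 : EuclideanSpace ℝ (Fin m))).hasFDerivAt
  have hr : ‖(0 : EuclideanSpace ℝ (Fin m))‖ ^ 2 + 4 ≠ 0 := by simp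
  have h1 := ((hasFDerivAt_inv hr).comp 0 (h0.add_const 4)).const_mul (-2)
  have h2 := h1.mul (ℓ.hasFDerivAt (x := 0))
  rw [partialDeriv]
  refine (congrArg (fun A : EuclideanSpace ℝ (Fin m) →L[ℝ] ℝ => A (EuclideanSpace.single i 1))
    h2.fderiv).trans ?_
  simp
  norm_num

theorem christoffel_sphereMetric_zero (p : UnitSphere m) (k i j : Fin m) :
    christoffel (sphereMetric m) p k i j 0 = 0 := by
  simp [christoffel_sphereMetric]

theorem partialDeriv_christoffel_sphereMetric (p : UnitSphere m) (a k i j : Fin m) :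
    partialDeriv a (christoffel (sphereMetric m) p k i j) 0
      = -(1 / 2) * ((1 : Matrix (Fin m) (Fin m) ℝ) a i * (1 : Matrix (Fin m) (Fin m) ℝ) j k
        + (1 : Matrix (Fin m) (Fin m) ℝ) a j * (1 : Matrix (Fin m) (Fin m) ℝ) i k
        - (1 : Matrix (Fin m) (Fin m) ℝ) a k * (1 : Matrix (Fin m) (Fin m) ℝ) i j) := by
  let pr : Fin m → EuclideanSpace ℝ (Fin m) →L[ℝ] ℝ := fun i => EuclideanSpace.proj i
  have h := partialDeriv_div_normSq_add_four
    ((1 : Matrix (Fin m) (Fin m) ℝ) j k • pr i + (1 : Matrix (Fin m) (Fin m) ℝ) i k • pr j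
      - (1 : Matrix (Fin m) (Fin m) ℝ) i j • pr k) a
  have h2 : christoffel (sphereMetric m) p k i j = fun y => -2 / (‖y‖ ^ 2 + 4) *
      ((1 : Matrix (Fin m) (Fin m) ℝ) j k • pr i + (1 : Matrix (Fin m) (Fin m) ℝ) i k • pr j
      - (1 : Matrix (Fin m) (Fin m) ℝ) i j • pr k) y := by
    funext y
    rw [christoffel_sphereMetric]
    have hp : ∀ b, pr b y = y b := fun _ => rfl
    simp only [sub_apply, add_apply, smul_apply, hp, smul_eq_mul]
    ring
  have h3 : ∀ b, pr b (EuclideanSpace.single a 1) = (1 : Matrix (Fin m) (Fin m) ℝ) a b := by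
    intro b
    simp [pr, Matrix.one_apply, eq_comm]
  rw [h2, h]
  simp [h3]
  ring

/-- At the chart centre the quadratic Christoffel terms drop out, and the contraction is the sum
over `i` of `δⱼₖ - δⱼᵢδᵢₖ`. -/
theorem ricciCoeff_sphereMetric (p : UnitSphere m) (j k : Fin m) :
    ricciCoeff (sphereMetric m) p j k 0 = (m - 1) * (1 : Matrix (Fin m) (Fin m) ℝ) j k := by
  simp only [ricciCoeff, curvatureCoeff, partialDeriv_christoffel_sphereMetric,
    christoffel_sphereMetric_zero]
  have h : ∀ i : Fin m, -(1 / 2 : ℝ) * ((1 : Matrix (Fin m) (Fin m) ℝ) i j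
          * (1 : Matrix (Fin m) (Fin m) ℝ) k i
        + (1 : Matrix (Fin m) (Fin m) ℝ) i k * (1 : Matrix (Fin m) (Fin m) ℝ) j i
        - (1 : Matrix (Fin m) (Fin m) ℝ) i i * (1 : Matrix (Fin m) (Fin m) ℝ) j k)
      - -(1 / 2) * ((1 : Matrix (Fin m) (Fin m) ℝ) j i * (1 : Matrix (Fin m) (Fin m) ℝ) k i
        + (1 : Matrix (Fin m) (Fin m) ℝ) j k * (1 : Matrix (Fin m) (Fin m) ℝ) i i
        - (1 : Matrix (Fin m) (Fin m) ℝ) j i * (1 : Matrix (Fin m) (Fin m) ℝ) i k)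
      + ∑ _s : Fin m, ((0 : ℝ) * 0 - 0 * 0)
      = (1 : Matrix (Fin m) (Fin m) ℝ) j k
        - (1 : Matrix (Fin m) (Fin m) ℝ) j i * (1 : Matrix (Fin m) (Fin m) ℝ) i k := by
    intro i
    have hs : ∀ a b : Fin m, (1 : Matrix (Fin m) (Fin m) ℝ) a b
        = (1 : Matrix (Fin m) (Fin m) ℝ) b a := fun a b => by simp [Matrix.one_apply, eq_comm]
    rw [hs i j, hs k i, Matrix.one_apply_eq]
    simp
    ring
  rw [Finset.sum_congr rfl fun i _ => h i, Finset.sum_sub_distrib, ← Matrix.mul_apply,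
    Matrix.one_mul]
  simp
  ring

theorem scalarCurvature_sphereMetric (p : UnitSphere m) :
    scalarCurvature (sphereMetric m) p = m * (m - 1) := by
  simp only [scalarCurvature, inv_metricCoeff_sphereMetric_self]
  rw [extChartAt_sphere_self]
  simp [ricciCoeff_sphereMetric, Matrix.one_apply, mul_sub]

variable {n : ℕ} {N : Type*} [TopologicalSpace N] [ChartedSpace (EuclideanSpace ℝ (Fin n)) N]
  [IsManifold (𝓡 n) ∞ N] (h : SmoothMetric n N) (ψ : UnitSphere m → N)

theorem differentialNormSq_sphereMetric (p : UnitSphere m) :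
    differentialNormSq (sphereMetric m) h ψ p = ∑ i, pullbackCoeff (m := m) h ψ p i i := by
  simp only [differentialNormSq, inv_metricCoeff_sphereMetric_self]
  simp [Matrix.one_apply]

theorem ricciTrace_sphereMetric (p : UnitSphere m) :
    ricciTrace (sphereMetric m) h ψ p
      = (m - 1) * differentialNormSq (sphereMetric m) h ψ p := by
  simp only [ricciTrace, inv_metricCoeff_sphereMetric_self, differentialNormSq_sphereMetric]
  rw [extChartAt_sphere_self]
  simp [ricciCoeff_sphereMetric, Matrix.one_apply, Finset.mul_sum]

theorem tensionField_sphereMetric (p : UnitSphere m) (c : Fin n) :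
    tensionField (sphereMetric m) h ψ p c
      = ∑ i, (partialDeriv i (partialDeriv i (mapCoord (m := m) (n := n) ψ p c)) 0
        + ∑ a, ∑ b, christoffel h (ψ p) c a b (extChartAt (𝓡 n) (ψ p) (ψ p))
          * partialDeriv i (mapCoord (m := m) (n := n) ψ p a) 0 * partialDeriv i (mapCoord (m := m) (n := n) ψ p b) 0) := by
  simp only [tensionField, inv_metricCoeff_sphereMetric_self]
  rw [extChartAt_sphere_self]
  simp [christoffel_sphereMetric_zero, Matrix.one_apply]

/-- Both curvature terms are multiples of `|dψ|²`, with total coefficient `(2/3)m(m-1) - 2(m-1) =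
(2/3)(m-1)(m-3)`. -/
theorem conformalBienergy_sphereMetric (ψ : C^∞⟮𝓡 m, UnitSphere m; 𝓡 n, N⟯)
    (vol : Measure (UnitSphere m)) :
    conformalBienergy (sphereMetric m) vol h ψ
      = (1 / 2) * ∫ p, (tensionNormSq (sphereMetric m) h ψ p
        + 2 / 3 * (m - 1) * (m - 3) * differentialNormSq (sphereMetric m) h ψ p) ∂vol := by
  rw [conformalBienergy]
  congr 2
  funext p
  rw [scalarCurvature_sphereMetric, ricciTrace_sphereMetric]
  ring

end SphereCurvature

/-! ### Chain rules for first and second partial derivatives. -/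

section PartialDerivatives

variable {m : ℕ}

theorem fderiv_eq_sum_partialDeriv (F : EuclideanSpace ℝ (Fin m) → ℝ)
    (y v : EuclideanSpace ℝ (Fin m)) :
    fderiv ℝ F y v = ∑ k, v k * partialDeriv k F y := by
  have h : v = ∑ k, v k • EuclideanSpace.single k (1 : ℝ) := by
    have := (EuclideanSpace.basisFun (Fin m) ℝ).sum_repr v
    simpa using this.symm
  conv_lhs => rw [h]
  simp [partialDeriv]

theorem partialDeriv_coord {s : EuclideanSpace ℝ (Fin m) → EuclideanSpace ℝ (Fin m)}
    {y : EuclideanSpace ℝ (Fin m)} (hs : DifferentiableAt ℝ s y) (i k : Fin m) :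
    partialDeriv i (fun z => s z k) y = fderiv ℝ s y (EuclideanSpace.single i 1) k := by
  have h := ((EuclideanSpace.proj k : EuclideanSpace ℝ (Fin m) →L[ℝ] ℝ).hasFDerivAt
    (x := s y)).comp y hs.hasFDerivAt
  exact congrArg (fun A : EuclideanSpace ℝ (Fin m) →L[ℝ] ℝ => A (EuclideanSpace.single i 1))
    h.fderiv

theorem partialDeriv_comp {F : EuclideanSpace ℝ (Fin m) → ℝ}
    {s : EuclideanSpace ℝ (Fin m) → EuclideanSpace ℝ (Fin m)} {y : EuclideanSpace ℝ (Fin m)}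
    (hF : DifferentiableAt ℝ F (s y)) (hs : DifferentiableAt ℝ s y) (i : Fin m) :
    partialDeriv i (fun z => F (s z)) y
      = ∑ k, partialDeriv k F (s y) * partialDeriv i (fun z => s z k) y := by
  have h := (hF.hasFDerivAt.comp y hs.hasFDerivAt).fderiv
  have h2 : partialDeriv i (fun z => F (s z)) y
      = fderiv ℝ F (s y) (fderiv ℝ s y (EuclideanSpace.single i 1)) :=
    congrArg (fun A : EuclideanSpace ℝ (Fin m) →L[ℝ] ℝ => A (EuclideanSpace.single i 1)) h
  rw [h2, fderiv_eq_sum_partialDeriv]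
  exact Finset.sum_congr rfl fun k _ => by rw [partialDeriv_coord hs, mul_comm]

theorem partialDeriv_congr {F G : EuclideanSpace ℝ (Fin m) → ℝ} {y : EuclideanSpace ℝ (Fin m)}
    (h : F =ᶠ[nhds y] G) (i : Fin m) : partialDeriv i F y = partialDeriv i G y := by
  rw [partialDeriv, partialDeriv, h.fderiv_eq]

theorem partialDeriv_eventuallyEq {F G : EuclideanSpace ℝ (Fin m) → ℝ}
    {y : EuclideanSpace ℝ (Fin m)} (h : F =ᶠ[nhds y] G) (i : Fin m) :
    partialDeriv i F =ᶠ[nhds y] partialDeriv i G :=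
  h.eventuallyEq_nhds.mono fun _ hz => partialDeriv_congr hz i

theorem ContDiffAt.partialDeriv {F : EuclideanSpace ℝ (Fin m) → ℝ}
    {y : EuclideanSpace ℝ (Fin m)} (hF : ContDiffAt ℝ ∞ F y) (i : Fin m) :
    ContDiffAt ℝ ∞ (partialDeriv i F) y :=
  (hF.fderiv_right (m := ∞) (by simp)).clm_apply contDiffAt_const

theorem partialDeriv_partialDeriv_comp {F : EuclideanSpace ℝ (Fin m) → ℝ}
    {s : EuclideanSpace ℝ (Fin m) → EuclideanSpace ℝ (Fin m)} {y : EuclideanSpace ℝ (Fin m)}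
    (hF : ContDiffAt ℝ ∞ F (s y)) (hs : ContDiffAt ℝ ∞ s y) (i : Fin m) :
    partialDeriv i (partialDeriv i (fun z => F (s z))) y
      = ∑ k, ∑ l, partialDeriv l (partialDeriv k F) (s y) *
          (partialDeriv i (fun z => s z l) y * partialDeriv i (fun z => s z k) y)
        + ∑ k, partialDeriv k F (s y) * partialDeriv i (partialDeriv i fun z => s z k) y := by
  have hsk : ∀ k, ContDiffAt ℝ ∞ (fun z => s z k) y := fun k =>
    (EuclideanSpace.proj k : EuclideanSpace ℝ (Fin m) →L[ℝ] ℝ).contDiff.contDiffAt.comp y hs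
  -- The first-order chain rule is needed on a neighbourhood, since it is differentiated again;
  -- being C¹ is an open condition, which supplies one.
  have h1 : partialDeriv i (fun z => F (s z)) =ᶠ[nhds y]
      fun z => ∑ k, partialDeriv k F (s z) * partialDeriv i (fun z => s z k) z := by
    have e1 := hs.continuousAt.eventually
      ((hF.of_le (m := 1) (by simp)).eventually (by simp))
    have e2 := (hs.of_le (m := 1) (by simp)).eventually (by simp)
    filter_upwards [e1, e2] with z hz1 hz2
    exact partialDeriv_comp (hz1.differentiableAt (by simp)) (hz2.differentiableAt (by simp)) i
  rw [partialDeriv_congr h1]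
  have hdF : ∀ k, DifferentiableAt ℝ (partialDeriv k F) (s y) := fun k =>
    (hF.partialDeriv k).differentiableAt (by simp)
  have hds : DifferentiableAt ℝ s y := hs.differentiableAt (by simp)
  have h2 : ∀ k, HasFDerivAt (fun z => partialDeriv k F (s z) * partialDeriv i (fun z => s z k) z)
      _ y := fun k => ((hdF k).comp y hds).hasFDerivAt.mul
        (((hsk k).partialDeriv i).differentiableAt (by simp)).hasFDerivAt
  have h3 := (HasFDerivAt.fun_sum fun k (_ : k ∈ Finset.univ) => h2 k).fderiv
  rw [partialDeriv, h3, ← Finset.sum_add_distrib]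
  simp only [sum_apply]
  refine Finset.sum_congr rfl fun k _ => ?_
  have h4 := partialDeriv_comp (hdF k) hds i
  have h5 : ∀ A B : EuclideanSpace ℝ (Fin m) →L[ℝ] ℝ, ∀ a b : ℝ, ∀ v,
    (a • A + b • B) v = a * A v + b * B v := fun A B a b v => rfl
  rw [h5, add_comm]
  congr 1
  refine (congrArg _ h4).trans ?_
  rw [Finset.mul_sum]
  exact Finset.sum_congr rfl fun l _ => by ring

end PartialDerivatives

/-! ### Energy density and tension field of a composition with a conformal map. -/

section Composition

variable {m n : ℕ} {N : Type*} [TopologicalSpace N] [ChartedSpace (EuclideanSpace ℝ (Fin n)) N]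

theorem contDiffAt_mapCoord (φ : C^∞⟮𝓡 m, UnitSphere m; 𝓡 n, N⟯) (q : UnitSphere m) (c : Fin n) :
    ContDiffAt ℝ ∞ (mapCoord (m := m) (n := n) φ q c) 0 := by
  have h := ((contMDiffAt_iff (I := 𝓡 m) (I' := 𝓡 n) (n := ∞)).1 (φ.contMDiff q)).2
  rw [extChartAt_sphere_self] at h
  have h2 : ContDiffAt ℝ ∞ (writtenInExtChartAt (𝓡 m) (𝓡 n) q φ) 0 := by
    simpa [contDiffWithinAt_univ] using h
  exact (EuclideanSpace.proj c : EuclideanSpace ℝ (Fin n) →L[ℝ] ℝ).contDiff.contDiffAt.comp 0 h2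

/-- Inserting the chart around `σ p` between `σ` and `φ` is legitimate only where `σ` stays in its
source, hence the restriction to a neighbourhood. -/
theorem mapCoord_comp_eventuallyEq (φ : UnitSphere m → N) {σ : UnitSphere m → UnitSphere m}
    (hσ : Continuous σ) (p : UnitSphere m) (c : Fin n) :
    mapCoord (m := m) (n := n) (φ ∘ σ) p c =ᶠ[nhds 0] fun y =>
      mapCoord (m := m) (n := n) φ (σ p) c
        ((writtenInExtChartAt (𝓡 m) (𝓡 m) p σ y : EuclideanSpace ℝ (Fin m))) := by
  have h1 : Continuous fun y => σ ((extChartAt (𝓡 m) p).symm y) :=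
    hσ.comp (contMDiff_extChartAt_sphere_symm p).continuous
  have h2 : σ ((extChartAt (𝓡 m) p).symm 0) = σ p := by
    rw [← extChartAt_sphere_self p, extChartAt_to_inv]
  have h3 := h1.continuousAt (x := 0) |>.preimage_mem_nhds (t := (extChartAt (𝓡 m) (σ p)).source)
    (by rw [h2]; exact extChartAt_source_mem_nhds (σ p))
  filter_upwards [h3] with y hy
  have h4 := (extChartAt (𝓡 m) (σ p)).left_inv hy
  simp only [mapCoord, writtenInExtChartAt, Function.comp]
  rw [h4]

theorem partialDeriv_mapCoord_comp (φ : C^∞⟮𝓡 m, UnitSphere m; 𝓡 n, N⟯)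
    {σ : UnitSphere m → UnitSphere m} (hσ : Continuous σ) (p : UnitSphere m)
    {s : EuclideanSpace ℝ (Fin m) → EuclideanSpace ℝ (Fin m)}
    (hs : ContDiffAt ℝ ∞ s 0) (hs0 : s 0 = 0)
    (hsσ : ∀ y, writtenInExtChartAt (𝓡 m) (𝓡 m) p σ y = s y) (i : Fin m) (a : Fin n) :
    partialDeriv i (mapCoord (m := m) (n := n) (φ ∘ σ) p a) 0
      = ∑ k, partialDeriv k (mapCoord (m := m) (n := n) φ (σ p) a) 0
        * partialDeriv i (fun z => s z k) 0 := by
  have h1 := mapCoord_comp_eventuallyEq φ hσ p a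
  simp only [hsσ] at h1
  have hF := contDiffAt_mapCoord φ (σ p) a
  rw [← hs0] at hF
  rw [partialDeriv_congr h1, partialDeriv_comp (hF.differentiableAt (by simp))
    (hs.differentiableAt (by simp)), hs0]

theorem partialDeriv_partialDeriv_mapCoord_comp (φ : C^∞⟮𝓡 m, UnitSphere m; 𝓡 n, N⟯)
    {σ : UnitSphere m → UnitSphere m} (hσ : Continuous σ) (p : UnitSphere m)
    {s : EuclideanSpace ℝ (Fin m) → EuclideanSpace ℝ (Fin m)}
    (hs : ContDiffAt ℝ ∞ s 0) (hs0 : s 0 = 0)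
    (hsσ : ∀ y, writtenInExtChartAt (𝓡 m) (𝓡 m) p σ y = s y) (i : Fin m) (a : Fin n) :
    partialDeriv i (partialDeriv i (mapCoord (m := m) (n := n) (φ ∘ σ) p a)) 0
      = ∑ k, ∑ l, partialDeriv l (partialDeriv k (mapCoord (m := m) (n := n) φ (σ p) a)) 0 *
          (partialDeriv i (fun z => s z l) 0 * partialDeriv i (fun z => s z k) 0)
        + ∑ k, partialDeriv k (mapCoord (m := m) (n := n) φ (σ p) a) 0
          * partialDeriv i (partialDeriv i fun z => s z k) 0 := by
  have h1 := mapCoord_comp_eventuallyEq φ hσ p a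
  simp only [hsσ] at h1
  have hF := contDiffAt_mapCoord φ (σ p) a
  rw [← hs0] at hF
  rw [partialDeriv_congr (partialDeriv_eventuallyEq h1 i), partialDeriv_partialDeriv_comp hF hs,
    hs0]

/-- `S` plays the Jacobian of a conformal map: `SᵀS = L·1` makes the trace of any pulled back
bilinear form scale by `L`. It serves both `|dφ|²` and the Christoffel term of the tension field. -/
theorem sum_bilin_of_conformal {H : Matrix (Fin n) (Fin n) ℝ} {F : Fin n → Fin m → ℝ}
    {S : Fin m → Fin m → ℝ} {L : ℝ}
    (hS : ∀ k l, ∑ i, S i k * S i l = L * (1 : Matrix (Fin m) (Fin m) ℝ) k l) :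
    ∑ i, ∑ a, ∑ b, H a b * (∑ k, F a k * S i k) * (∑ k, F b k * S i k)
      = L * ∑ i, ∑ a, ∑ b, H a b * F a i * F b i := by
  have h1 : ∀ a b, ∑ i, (∑ k, F a k * S i k) * (∑ l, F b l * S i l)
      = L * ∑ i, F a i * F b i := by
    intro a b
    simp only [Finset.sum_mul_sum]
    rw [Finset.sum_comm, Finset.mul_sum]
    refine Finset.sum_congr rfl fun k _ => ?_
    rw [Finset.sum_comm]
    have h2 : ∀ l, ∑ i, F a k * S i k * (F b l * S i l)
        = F a k * F b l * (L * (1 : Matrix (Fin m) (Fin m) ℝ) k l) := by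
      intro l
      rw [← hS, Finset.mul_sum]
      exact Finset.sum_congr rfl fun i _ => by ring
    simp only [h2, Matrix.one_apply]
    simp
    ring
  have h3 : ∀ G : Fin m → Fin n → Fin n → ℝ,
      ∑ i, ∑ a, ∑ b, G i a b = ∑ a, ∑ b, ∑ i, G i a b := by
    intro G
    rw [Finset.sum_comm]
    exact Finset.sum_congr rfl fun a _ => Finset.sum_comm
  rw [h3, h3, Finset.mul_sum]
  refine Finset.sum_congr rfl fun a _ => ?_
  rw [Finset.mul_sum]
  refine Finset.sum_congr rfl fun b _ => ?_
  simp only [mul_assoc]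
  rw [← Finset.mul_sum, ← Finset.mul_sum, h1]
  ring

variable [IsManifold (𝓡 n) ∞ N]

theorem differentialNormSq_comp (h : SmoothMetric n N) (φ : C^∞⟮𝓡 m, UnitSphere m; 𝓡 n, N⟯)
    {σ : UnitSphere m → UnitSphere m} (hσ : Continuous σ) (p : UnitSphere m)
    {s : EuclideanSpace ℝ (Fin m) → EuclideanSpace ℝ (Fin m)}
    (hs : ContDiffAt ℝ ∞ s 0) (hs0 : s 0 = 0)
    (hsσ : ∀ y, writtenInExtChartAt (𝓡 m) (𝓡 m) p σ y = s y) {L : ℝ}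
    (hL : ∀ k l, ∑ i, partialDeriv i (fun z => s z k) 0 * partialDeriv i (fun z => s z l) 0
      = L * (1 : Matrix (Fin m) (Fin m) ℝ) k l) :
    differentialNormSq (sphereMetric m) h (φ ∘ σ) p
      = L * differentialNormSq (sphereMetric m) h φ (σ p) := by
  simp only [differentialNormSq_sphereMetric, pullbackCoeff, extChartAt_sphere_self,
    partialDeriv_mapCoord_comp φ hσ p hs hs0 hsσ]
  exact sum_bilin_of_conformal hL

/-- The composition law `τ(φ∘σ) = Tr ∇dφ(dσ,dσ) + dφ(τ(σ))`. Conformality turns the first term into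
`L τ(φ)`. As the sphere's Christoffel symbols vanish at both chart centres, the flat Laplacian of
`s` at the origin is `τ(σ)`. -/
theorem tensionField_comp (h : SmoothMetric n N) (φ : C^∞⟮𝓡 m, UnitSphere m; 𝓡 n, N⟯)
    {σ : UnitSphere m → UnitSphere m} (hσ : Continuous σ) (p : UnitSphere m)
    {s : EuclideanSpace ℝ (Fin m) → EuclideanSpace ℝ (Fin m)}
    (hs : ContDiffAt ℝ ∞ s 0) (hs0 : s 0 = 0)
    (hsσ : ∀ y, writtenInExtChartAt (𝓡 m) (𝓡 m) p σ y = s y) {L : ℝ}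
    (hL : ∀ k l, ∑ i, partialDeriv i (fun z => s z k) 0 * partialDeriv i (fun z => s z l) 0
      = L * (1 : Matrix (Fin m) (Fin m) ℝ) k l) (c : Fin n) :
    tensionField (sphereMetric m) h (φ ∘ σ) p c
      = L * tensionField (sphereMetric m) h φ (σ p) c
        + ∑ k, (∑ i, partialDeriv i (partialDeriv i fun z => s z k) 0)
          * partialDeriv k (mapCoord (m := m) (n := n) φ (σ p) c) 0 := by
  simp only [tensionField_sphereMetric, Finset.sum_add_distrib,
    partialDeriv_mapCoord_comp φ hσ p hs hs0 hsσ,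
    partialDeriv_partialDeriv_mapCoord_comp φ hσ p hs hs0 hsσ]
  have h0 := sum_bilin_of_conformal (H := Matrix.of fun a b =>
    christoffel h (φ (σ p)) c a b (extChartAt (𝓡 n) (φ (σ p)) (φ (σ p))))
    (F := fun a k => partialDeriv k (mapCoord (m := m) (n := n) φ (σ p) a) 0) hL
  simp only [Matrix.of_apply] at h0
  have h1 : ∑ i, ∑ k, ∑ l, partialDeriv l (partialDeriv k
        (mapCoord (m := m) (n := n) φ (σ p) c)) 0 *
          (partialDeriv i (fun z => s z l) 0 * partialDeriv i (fun z => s z k) 0)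
      = L * ∑ k, partialDeriv k (partialDeriv k (mapCoord (m := m) (n := n) φ (σ p) c)) 0 := by
    rw [Finset.sum_comm, Finset.mul_sum]
    refine Finset.sum_congr rfl fun k _ => ?_
    rw [Finset.sum_comm]
    simp only [← Finset.mul_sum, hL, Matrix.one_apply]
    simp [mul_comm]
  have h2 : ∑ i, ∑ k, partialDeriv k (mapCoord (m := m) (n := n) φ (σ p) c) 0
          * partialDeriv i (partialDeriv i fun z => s z k) 0
      = ∑ k, (∑ i, partialDeriv i (partialDeriv i fun z => s z k) 0)
          * partialDeriv k (mapCoord (m := m) (n := n) φ (σ p) c) 0 := by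
    rw [Finset.sum_comm]
    refine Finset.sum_congr rfl fun k _ => ?_
    rw [← Finset.mul_sum, mul_comm]
  rw [h1, h2]
  simp only [Function.comp_apply]
  rw [h0]
  ring

theorem sum_metricCoeff_mul (h : SmoothMetric n N) (c : N) (y : EuclideanSpace ℝ (Fin n))
    (v w : Fin n → ℝ) :
    ∑ a, ∑ b, metricCoeff h c y a b * v a * w b
      = h.inner ((extChartAt (𝓡 n) c).symm y) (∑ a, v a • coordVec c y a)
        (∑ b, w b • coordVec c y b) := by
  simp only [map_sum, map_smul, sum_apply, smul_apply, smul_eq_mul, metricCoeff, Matrix.of_apply,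
    Finset.mul_sum]
  rw [Finset.sum_comm]
  exact Finset.sum_congr rfl fun a _ => Finset.sum_congr rfl fun b _ => by ring

theorem SmoothMetric.inner_self_nonneg (h : SmoothMetric n N) (x : N) (v : TangentSpace (𝓡 n) x) :
    0 ≤ h.inner x v v := by
  by_cases hv : v = 0
  · simp [hv]
  · exact (h.pos x v hv).le

theorem sum_metricCoeff_mul_self_nonneg (h : SmoothMetric n N) (c : N)
    (y : EuclideanSpace ℝ (Fin n)) (v : Fin n → ℝ) :
    0 ≤ ∑ a, ∑ b, metricCoeff h c y a b * v a * v b := by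
  rw [sum_metricCoeff_mul]
  exact SmoothMetric.inner_self_nonneg h _ _

/-- Cauchy–Schwarz in the form of Lagrange's identity: the defect is half the sum of the squared
lengths of `t k • w l - t l • w k`. -/
theorem SmoothMetric.inner_sum_smul_self_le (h : SmoothMetric n N) (x : N) (t : Fin m → ℝ)
    (w : Fin m → TangentSpace (𝓡 n) x) :
    h.inner x (∑ k, t k • w k) (∑ k, t k • w k) ≤ (∑ k, t k ^ 2) * ∑ k, h.inner x (w k) (w k) := by
  have h1 : 0 ≤ ∑ k, ∑ l, h.inner x (t k • w l - t l • w k) (t k • w l - t l • w k) :=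
    Finset.sum_nonneg fun k _ => Finset.sum_nonneg fun l _ =>
      SmoothMetric.inner_self_nonneg h _ _
  have h2 : ∀ k l, h.inner x (t k • w l - t l • w k) (t k • w l - t l • w k)
      = t k ^ 2 * h.inner x (w l) (w l) + h.inner x (w k) (w k) * t l ^ 2
        - 2 * (t k * (t l * h.inner x (w k) (w l))) := by
    intro k l
    simp only [map_sub, map_smul, sub_apply, smul_apply, smul_eq_mul]
    rw [h.symm x (w l) (w k)]
    ring
  have h3 : h.inner x (∑ k, t k • w k) (∑ k, t k • w k)
      = ∑ k, ∑ l, t k * (t l * h.inner x (w k) (w l)) := by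
    simp only [map_sum, map_smul, sum_apply, smul_apply, smul_eq_mul]
    rw [Finset.sum_comm]
    simp only [Finset.mul_sum]
    exact Finset.sum_congr rfl fun k _ => Finset.sum_congr rfl fun l _ => by ring
  simp only [h2, Finset.sum_sub_distrib, Finset.sum_add_distrib, ← Finset.mul_sum,
    ← Finset.sum_mul] at h1
  rw [h3]
  have h4 : ∑ k, t k * ∑ l, t l * h.inner x (w k) (w l)
      = ∑ k, ∑ l, t k * (t l * h.inner x (w k) (w l)) := by simp only [Finset.mul_sum]
  rw [h4] at h1
  linarith [mul_comm (∑ k, h.inner x (w k) (w k)) (∑ k, t k ^ 2)]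

/-- The coefficients in the chart around `φ q` of the images under the differential of `φ` of the
coordinate vectors at `q`, as a tangent vector. -/
def differentialVec (φ : UnitSphere m → N) (q : UnitSphere m) (i : Fin m) :
    TangentSpace (𝓡 n) ((extChartAt (𝓡 n) (φ q)).symm (extChartAt (𝓡 n) (φ q) (φ q))) :=
  ∑ a, partialDeriv i (mapCoord (m := m) (n := n) φ q a) 0
    • coordVec (φ q) (extChartAt (𝓡 n) (φ q) (φ q)) a

theorem differentialNormSq_eq_sum_inner (h : SmoothMetric n N) (φ : UnitSphere m → N)
    (q : UnitSphere m) :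
    differentialNormSq (sphereMetric m) h φ q
      = ∑ i, h.inner _ (differentialVec φ q i) (differentialVec φ q i) := by
  simp only [differentialNormSq_sphereMetric, pullbackCoeff, extChartAt_sphere_self]
  exact Finset.sum_congr rfl fun i _ => sum_metricCoeff_mul h _ _ _ _

theorem differentialNormSq_nonneg (h : SmoothMetric n N) (φ : UnitSphere m → N)
    (q : UnitSphere m) : 0 ≤ differentialNormSq (sphereMetric m) h φ q := by
  rw [differentialNormSq_eq_sum_inner]
  exact Finset.sum_nonneg fun i _ => SmoothMetric.inner_self_nonneg h _ _

theorem tensionNormSq_nonneg (h : SmoothMetric n N) (φ : UnitSphere m → N)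
    (q : UnitSphere m) : 0 ≤ tensionNormSq (sphereMetric m) h φ q :=
  sum_metricCoeff_mul_self_nonneg h _ _ _

/-- Harmonicity leaves only `dφ(τ(σ))`, whose squared length is at most `|τ(σ)|² |dφ|²`. -/
theorem tensionNormSq_comp_le (h : SmoothMetric n N) (φ : C^∞⟮𝓡 m, UnitSphere m; 𝓡 n, N⟯)
    (hφ : IsHarmonicMap (sphereMetric m) h φ)
    {σ : UnitSphere m → UnitSphere m} (hσ : Continuous σ) (p : UnitSphere m)
    {s : EuclideanSpace ℝ (Fin m) → EuclideanSpace ℝ (Fin m)}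
    (hs : ContDiffAt ℝ ∞ s 0) (hs0 : s 0 = 0)
    (hsσ : ∀ y, writtenInExtChartAt (𝓡 m) (𝓡 m) p σ y = s y) {L : ℝ}
    (hL : ∀ k l, ∑ i, partialDeriv i (fun z => s z k) 0 * partialDeriv i (fun z => s z l) 0
      = L * (1 : Matrix (Fin m) (Fin m) ℝ) k l) :
    tensionNormSq (sphereMetric m) h (φ ∘ σ) p
      ≤ (∑ k, (∑ i, partialDeriv i (partialDeriv i fun z => s z k) 0) ^ 2)
        * differentialNormSq (sphereMetric m) h φ (σ p) := by
  simp only [tensionNormSq, tensionField_comp h φ hσ p hs hs0 hsσ hL, hφ (σ p), mul_zero, zero_add,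
    Function.comp_apply]
  rw [sum_metricCoeff_mul, differentialNormSq_eq_sum_inner]
  have h1 := SmoothMetric.inner_sum_smul_self_le h _
    (fun k => ∑ i, partialDeriv i (partialDeriv i fun z => s z k) 0) (differentialVec φ (σ p))
  refine le_trans (le_of_eq ?_) h1
  have h2 : ∑ a, (∑ k, (∑ i, partialDeriv i (partialDeriv i fun z => s z k) 0)
          * partialDeriv k (mapCoord (m := m) (n := n) φ (σ p) a) 0)
        • coordVec (φ (σ p)) (extChartAt (𝓡 n) (φ (σ p)) (φ (σ p))) a
      = ∑ k, (∑ i, partialDeriv i (partialDeriv i fun z => s z k) 0)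
        • differentialVec φ (σ p) k := by
    simp only [differentialVec, Finset.smul_sum, Finset.sum_smul, smul_smul]
    exact Finset.sum_comm
  rw [h2]

end Composition

/-! ### Derivatives at the origin of quotients of quadratic polynomials. -/

section QuadraticQuotient

variable {m : ℕ}

theorem hasFDerivAt_quadratic (ℓ : EuclideanSpace ℝ (Fin m) →L[ℝ] ℝ) (μ c : ℝ)
    (y : EuclideanSpace ℝ (Fin m)) :
    HasFDerivAt (fun y => c + ℓ y + μ * ‖y‖ ^ 2) (ℓ + (2 * μ) • innerSL ℝ y) y := by
  refine (((ℓ.hasFDerivAt (x := y)).const_add c).add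
    ((hasStrictFDerivAt_norm_sq y).hasFDerivAt.const_mul μ)).congr_fderiv ?_
  ext v
  simp
  ring

theorem HasFDerivAt.real_div {E : Type*} [NormedAddCommGroup E] [NormedSpace ℝ E] {f g : E → ℝ}
    {f' g' : E →L[ℝ] ℝ} {x : E} (hf : HasFDerivAt f f' x) (hg : HasFDerivAt g g' x)
    (hx : g x ≠ 0) :
    HasFDerivAt (fun y => f y / g y) ((g x ^ 2)⁻¹ • (g x • f' - f x • g')) x := by
  have h := hf.mul ((hasFDerivAt_inv hx).comp x hg)
  refine h.congr_fderiv ?_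
  ext v
  simp
  field_simp
  ring

theorem partialDeriv_quadratic_div (ℓ b : EuclideanSpace ℝ (Fin m) →L[ℝ] ℝ) (μ κ Q : ℝ)
    (i : Fin m) {y : EuclideanSpace ℝ (Fin m)} (hy : Q + b y + κ * ‖y‖ ^ 2 ≠ 0) :
    partialDeriv i (fun y => (0 + ℓ y + μ * ‖y‖ ^ 2) / (Q + b y + κ * ‖y‖ ^ 2)) y
      = ((ℓ (EuclideanSpace.single i 1) + 2 * μ * y i) * (Q + b y + κ * ‖y‖ ^ 2)
        - (0 + ℓ y + μ * ‖y‖ ^ 2) * (b (EuclideanSpace.single i 1) + 2 * κ * y i))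
        / (Q + b y + κ * ‖y‖ ^ 2) ^ 2 := by
  have h := ((hasFDerivAt_quadratic ℓ μ 0 y).real_div (hasFDerivAt_quadratic b κ Q y) hy).fderiv
  rw [partialDeriv, h]
  simp [EuclideanSpace.inner_single_right]
  field_simp

theorem partialDeriv_quadratic_div_zero (ℓ b : EuclideanSpace ℝ (Fin m) →L[ℝ] ℝ) (μ κ : ℝ)
    {Q : ℝ} (hQ : Q ≠ 0) (i : Fin m) :
    partialDeriv i (fun y => (0 + ℓ y + μ * ‖y‖ ^ 2) / (Q + b y + κ * ‖y‖ ^ 2)) 0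
      = ℓ (EuclideanSpace.single i 1) / Q := by
  rw [partialDeriv_quadratic_div _ _ _ _ _ _ (by simpa using hQ)]
  simp
  field_simp

theorem partialDeriv_partialDeriv_quadratic_div_zero (ℓ b : EuclideanSpace ℝ (Fin m) →L[ℝ] ℝ)
    (μ κ : ℝ) {Q : ℝ} (hQ : Q ≠ 0) (i : Fin m) :
    partialDeriv i (partialDeriv i
        (fun y => (0 + ℓ y + μ * ‖y‖ ^ 2) / (Q + b y + κ * ‖y‖ ^ 2))) 0
      = 2 * μ / Q - 2 * (ℓ (EuclideanSpace.single i 1) * b (EuclideanSpace.single i 1)) / Q ^ 2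
    := by
  have hc : ContinuousAt (fun y : EuclideanSpace ℝ (Fin m) => Q + b y + κ * ‖y‖ ^ 2) 0 :=
    (hasFDerivAt_quadratic b κ Q 0).continuousAt
  have he := hc.eventually_ne (y := 0) (by simpa using hQ)
  rw [partialDeriv_congr (he.mono fun y hy => partialDeriv_quadratic_div ℓ b μ κ Q i hy)]
  let pr : EuclideanSpace ℝ (Fin m) →L[ℝ] ℝ := EuclideanSpace.proj i
  have hp : HasFDerivAt (fun y : EuclideanSpace ℝ (Fin m) => y i) pr 0 := pr.hasFDerivAt
  have hpi : pr (EuclideanSpace.single i 1) = 1 := by simp [pr]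
  have hden := hasFDerivAt_quadratic b κ Q 0
  have hnum := hasFDerivAt_quadratic ℓ μ 0 0
  have h1 := ((((hp.const_mul (2 * μ)).const_add (ℓ (EuclideanSpace.single i 1))).mul hden).sub
    (hnum.mul ((hp.const_mul (2 * κ)).const_add (b (EuclideanSpace.single i 1))))).real_div
    (hden.pow 2) (by simpa using hQ)
  rw [partialDeriv]
  refine (congrArg (fun A : EuclideanSpace ℝ (Fin m) →L[ℝ] ℝ => A (EuclideanSpace.single i 1))
    h1.fderiv).trans ?_
  simp [hpi]
  field_simp
  ring

end QuadraticQuotient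

/-! ### Conformal dilations of the sphere. -/

section ConformalDilation

variable {m : ℕ}

/-- The formula for the conformal dilation of the unit sphere with parameter `a`, on the ambient
space. -/
def dilationFun (a x : EuclideanSpace ℝ (Fin (m + 1))) : EuclideanSpace ℝ (Fin (m + 1)) :=
  (1 + 2 * inner ℝ a x + ‖a‖ ^ 2)⁻¹ • ((1 - ‖a‖ ^ 2) • x + (2 * (1 + inner ℝ a x)) • a)

theorem norm_add_sphere_sq (a : EuclideanSpace ℝ (Fin (m + 1))) (x : UnitSphere m) :
    ‖(x : EuclideanSpace ℝ (Fin (m + 1))) + a‖ ^ 2 = 1 + 2 * inner ℝ a x + ‖a‖ ^ 2 := by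
  rw [norm_add_sq_real, norm_eq_of_mem_sphere, real_inner_comm]
  ring

/-- The denominator is `‖x + a‖²`, which could vanish only if `a = -x` had norm one. -/
theorem dilation_denom_pos {a : EuclideanSpace ℝ (Fin (m + 1))} (ha : ‖a‖ < 1)
    (x : UnitSphere m) : 0 < 1 + 2 * inner ℝ a x + ‖a‖ ^ 2 := by
  rw [← norm_add_sphere_sq]
  have h : (x : EuclideanSpace ℝ (Fin (m + 1))) + a ≠ 0 := by
    intro h0
    have h1 := norm_eq_of_mem_sphere x
    rw [eq_neg_of_add_eq_zero_left h0, norm_neg] at h1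
    exact ha.ne h1
  positivity

theorem dilationFun_mem_sphere {a : EuclideanSpace ℝ (Fin (m + 1))} (ha : ‖a‖ < 1)
    (x : UnitSphere m) :
    dilationFun a x ∈ Metric.sphere (0 : EuclideanSpace ℝ (Fin (m + 1))) 1 := by
  have hD := dilation_denom_pos ha x
  rw [mem_sphere_zero_iff_norm, ← sq_eq_sq₀ (norm_nonneg _) zero_le_one, ← real_inner_self_eq_norm_sq]
  have h1 := inner_self_sphere x
  have h2 := real_inner_self_eq_norm_sq a
  simp only [dilationFun, inner_add_left, inner_add_right, inner_smul_left, inner_smul_right, h1, h2,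
    real_inner_comm a (x : EuclideanSpace ℝ (Fin (m + 1)))]
  simp
  field_simp
  ring

theorem contMDiff_dilationFun {a : EuclideanSpace ℝ (Fin (m + 1))} (ha : ‖a‖ < 1) :
    ContMDiff (𝓡 m) 𝓘(ℝ, EuclideanSpace ℝ (Fin (m + 1))) ∞
      fun x : UnitSphere m => dilationFun a x := by
  have := Fact.mk (@finrank_euclideanSpace_fin ℝ _ (m + 1))
  intro x
  have h1 : ContMDiffAt (𝓡 m) 𝓘(ℝ, EuclideanSpace ℝ (Fin (m + 1))) ∞
    ((↑) : UnitSphere m → EuclideanSpace ℝ (Fin (m + 1))) x := contMDiff_coe_sphere x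
  have hi : ContDiff ℝ ∞ fun z : EuclideanSpace ℝ (Fin (m + 1)) => inner ℝ a z :=
    contDiff_const.inner ℝ contDiff_id
  have h2 : ContDiffAt ℝ ∞ (dilationFun a) (x : EuclideanSpace ℝ (Fin (m + 1))) := by
    have h3 : ContDiffAt ℝ ∞ (fun z => 1 + 2 * inner ℝ a z + ‖a‖ ^ 2)
        (x : EuclideanSpace ℝ (Fin (m + 1))) :=
      ((contDiff_const.add (contDiff_const.mul hi)).add contDiff_const).contDiffAt
    refine (h3.inv (dilation_denom_pos ha x).ne').smul ?_
    exact ((contDiff_id.const_smul (1 - ‖a‖ ^ 2)).add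
      ((contDiff_const.mul (contDiff_const.add hi)).smul contDiff_const)).contDiffAt
  exact h2.contMDiffAt.comp x h1

/-- The conformal dilation of the unit sphere with parameter `a` in the open unit ball. -/
def dilation (a : EuclideanSpace ℝ (Fin (m + 1))) (ha : ‖a‖ < 1) :
    C^∞⟮𝓡 m, UnitSphere m; 𝓡 m, UnitSphere m⟯ :=
  ⟨fun x => ⟨dilationFun a x, dilationFun_mem_sphere ha x⟩, by
    have := Fact.mk (@finrank_euclideanSpace_fin ℝ _ (m + 1))
    exact (contMDiff_dilationFun ha).codRestrict_sphere (dilationFun_mem_sphere ha)⟩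

theorem coe_dilation (a : EuclideanSpace ℝ (Fin (m + 1))) (ha : ‖a‖ < 1) (x : UnitSphere m) :
    (dilation a ha x : EuclideanSpace ℝ (Fin (m + 1))) = dilationFun a x := rfl

end ConformalDilation

/-! ### Dilations in stereographic coordinates: Jacobian and Laplacian at the centre. -/

section DilationTransition

variable {m : ℕ}

/-- Twice the linear part of the numerator of a conformal dilation in stereographic coordinates. -/
def dilationVec (a : EuclideanSpace ℝ (Fin (m + 1))) (p : UnitSphere m)
    (y : EuclideanSpace ℝ (Fin m)) : EuclideanSpace ℝ (Fin (m + 1)) :=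
  (8 * (1 - ‖a‖ ^ 2)) • tangentFrame p y + (16 * inner ℝ a (tangentFrame p y)) • a

/-- `dilationVec` as a family of coordinate functionals. -/
def dilationLin (a : EuclideanSpace ℝ (Fin (m + 1))) (p q : UnitSphere m) (k : Fin m) :
    EuclideanSpace ℝ (Fin m) →L[ℝ] ℝ :=
  (innerSL ℝ (tangentFrame q (EuclideanSpace.single k 1))).comp
    ((8 * (1 - ‖a‖ ^ 2)) • (tangentFrame p).toContinuousLinearMap
      + ((16 : ℝ) • (innerSL ℝ a).comp (tangentFrame p).toContinuousLinearMap).smulRight a)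

theorem dilationLin_apply (a : EuclideanSpace ℝ (Fin (m + 1))) (p q : UnitSphere m) (k : Fin m)
    (y : EuclideanSpace ℝ (Fin m)) :
    dilationLin a p q k y
      = inner ℝ (tangentFrame q (EuclideanSpace.single k 1)) (dilationVec a p y) := rfl

/-- The linear part of the denominator of a conformal dilation in stereographic coordinates. -/
def dilationDenLin (a : EuclideanSpace ℝ (Fin (m + 1))) (p : UnitSphere m) :
    EuclideanSpace ℝ (Fin m) →L[ℝ] ℝ :=
  (16 : ℝ) • (innerSL ℝ a).comp (tangentFrame p).toContinuousLinearMap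

theorem dilationDenLin_apply (a : EuclideanSpace ℝ (Fin (m + 1))) (p : UnitSphere m)
    (y : EuclideanSpace ℝ (Fin m)) :
    dilationDenLin a p y = 16 * inner ℝ a (tangentFrame p y) := rfl

/-- The quadratic coefficient of the denominator of a conformal dilation in stereographic
coordinates. -/
def dilationDenQuad (a : EuclideanSpace ℝ (Fin (m + 1))) (p q : UnitSphere m) : ℝ :=
  1 + ‖a‖ ^ 2 - 2 * inner ℝ a p
    - (1 - ‖a‖ ^ 2) * inner ℝ (q : EuclideanSpace ℝ (Fin (m + 1))) p
    + 2 * (1 - inner ℝ a p) * inner ℝ (q : EuclideanSpace ℝ (Fin (m + 1))) a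

/-- A conformal dilation in stereographic coordinates around `p` and `q`. -/
def dilationTransition (a : EuclideanSpace ℝ (Fin (m + 1))) (p q : UnitSphere m)
    (y : EuclideanSpace ℝ (Fin m)) : EuclideanSpace ℝ (Fin m) :=
  WithLp.toLp 2 fun k => (0 + dilationLin a p q k y
      + 8 * inner ℝ (tangentFrame q (EuclideanSpace.single k 1)) a * ‖y‖ ^ 2)
    / (8 * (1 + 2 * inner ℝ a p + ‖a‖ ^ 2) + dilationDenLin a p y + dilationDenQuad a p q * ‖y‖ ^ 2)

theorem dilationTransition_zero (a : EuclideanSpace ℝ (Fin (m + 1))) (p q : UnitSphere m) :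
    dilationTransition a p q 0 = 0 := by
  ext k
  simp [dilationTransition]

variable {a : EuclideanSpace ℝ (Fin (m + 1))}

theorem one_sub_normSq_pos (ha : ‖a‖ < 1) : 0 < 1 - ‖a‖ ^ 2 := by
  nlinarith [norm_nonneg a]

variable (ha : ‖a‖ < 1)

/-- Stated with the denominator cleared, so that this and the relations derived from it can be fed
to `linear_combination`. -/
theorem inner_dilation (p : UnitSphere m) (z : EuclideanSpace ℝ (Fin (m + 1))) :
    (1 + 2 * inner ℝ a p + ‖a‖ ^ 2)
        * inner ℝ (dilation a ha p : EuclideanSpace ℝ (Fin (m + 1))) z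
      = (1 - ‖a‖ ^ 2) * inner ℝ (p : EuclideanSpace ℝ (Fin (m + 1))) z
        + 2 * (1 + inner ℝ a p) * inner ℝ a z := by
  have hD := dilation_denom_pos ha p
  rw [coe_dilation, dilationFun, inner_smul_left, inner_add_left, inner_smul_left, inner_smul_left]
  simp
  field_simp

/-- Orthogonality of the frame at `σ p` to `σ p` itself, expressed through `p` and `a`. -/
theorem inner_tangentFrame_dilation (p : UnitSphere m) (y : EuclideanSpace ℝ (Fin m)) :
    (1 - ‖a‖ ^ 2) * inner ℝ (tangentFrame (dilation a ha p) y)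
        (p : EuclideanSpace ℝ (Fin (m + 1)))
      + 2 * (1 + inner ℝ a p) * inner ℝ (tangentFrame (dilation a ha p) y) a = 0 := by
  have h := inner_dilation ha p (tangentFrame (dilation a ha p) y)
  rw [inner_sphere_tangentFrame, mul_zero] at h
  rw [real_inner_comm, real_inner_comm a]
  exact h.symm

theorem inner_dilation_tangentFrame (p : UnitSphere m) (y : EuclideanSpace ℝ (Fin m)) :
    (1 + 2 * inner ℝ a p + ‖a‖ ^ 2) * inner ℝ
        (dilation a ha p : EuclideanSpace ℝ (Fin (m + 1))) (tangentFrame p y)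
      = 2 * (1 + inner ℝ a p) * inner ℝ a (tangentFrame p y) := by
  rw [inner_dilation, inner_sphere_tangentFrame, mul_zero, zero_add]

theorem inner_dilation_param (p : UnitSphere m) :
    (1 + 2 * inner ℝ a p + ‖a‖ ^ 2) * inner ℝ
        (dilation a ha p : EuclideanSpace ℝ (Fin (m + 1))) a
      = (1 - ‖a‖ ^ 2) * inner ℝ a p + 2 * (1 + inner ℝ a p) * ‖a‖ ^ 2 := by
  rw [inner_dilation, real_inner_comm, real_inner_self_eq_norm_sq]

theorem inner_dilation_self (p : UnitSphere m) :
    (1 + 2 * inner ℝ a p + ‖a‖ ^ 2) * inner ℝ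
        (dilation a ha p : EuclideanSpace ℝ (Fin (m + 1))) p
      = (1 - ‖a‖ ^ 2) + 2 * (1 + inner ℝ a p) * inner ℝ a p := by
  rw [inner_dilation, inner_self_sphere, mul_one]

/-- Chart, dilation and inverse chart are all rational. After cancelling the common factor `(‖y‖² +
4)(1 + 2⟨a,x⟩ + ‖a‖²)`, numerator and denominator become quadratic in `y`; the constant term of the
numerator vanishes because `σ p` is the chart centre. -/
theorem writtenInExtChartAt_dilation (p : UnitSphere m) (y : EuclideanSpace ℝ (Fin m)) :
    writtenInExtChartAt (𝓡 m) (𝓡 m) p (dilation a ha) y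
      = dilationTransition a p (dilation a ha p) y := by
  set q := dilation a ha p with hq
  let x : UnitSphere m := (extChartAt (𝓡 m) p).symm y
  have hx : (x : EuclideanSpace ℝ (Fin (m + 1))) = stereoParam p y :=
    extChartAt_sphere_symm_apply p y
  have hD := dilation_denom_pos ha x
  have hD0 := dilation_denom_pos ha p
  have hr : (0 : ℝ) < ‖y‖ ^ 2 + 4 := by positivity
  have hi : ∀ z : EuclideanSpace ℝ (Fin (m + 1)), (‖y‖ ^ 2 + 4) *
      inner ℝ z (x : EuclideanSpace ℝ (Fin (m + 1)))
      = 4 * inner ℝ z (tangentFrame p y) + (4 - ‖y‖ ^ 2) * inner ℝ z p := by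
    intro z
    rw [hx, stereoParam, inner_smul_right, inner_add_right, inner_smul_right, inner_smul_right]
    field_simp
  have hσ : ∀ z : EuclideanSpace ℝ (Fin (m + 1)), (1 + 2 * inner ℝ a x + ‖a‖ ^ 2) *
      inner ℝ z (dilation a ha x : EuclideanSpace ℝ (Fin (m + 1)))
      = (1 - ‖a‖ ^ 2) * inner ℝ z (x : EuclideanSpace ℝ (Fin (m + 1)))
        + 2 * (1 + inner ℝ a x) * inner ℝ z a := by
    intro z
    have := inner_dilation ha x z
    rw [real_inner_comm z, real_inner_comm z, real_inner_comm z] at this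
    exact this
  ext k
  have e1 : (writtenInExtChartAt (𝓡 m) (𝓡 m) p (dilation a ha) y : EuclideanSpace ℝ (Fin m)) k
      = 2 / (1 + inner ℝ (q : EuclideanSpace ℝ (Fin (m + 1))) (dilation a ha x))
        * inner ℝ (tangentFrame q (EuclideanSpace.single k 1))
          (dilation a ha x : EuclideanSpace ℝ _) := by
    rw [← extChartAt_sphere_apply]
    rfl
  rw [e1]
  have r1 := inner_tangentFrame_dilation ha p (EuclideanSpace.single k 1)
  have r2 := inner_dilation_tangentFrame ha p y
  have r3 := inner_dilation_param ha p
  have r4 := inner_dilation_self ha p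
  rw [← hq] at r1 r2 r3 r4
  have i1 := hi a
  have i2 := hi (q : EuclideanSpace ℝ (Fin (m + 1)))
  have i3 := hi (tangentFrame q (EuclideanSpace.single k 1))
  have s2 := hσ (q : EuclideanSpace ℝ (Fin (m + 1)))
  have s3 := hσ (tangentFrame q (EuclideanSpace.single k 1))
  simp only [dilationTransition, dilationLin_apply, dilationVec, dilationDenLin_apply,
    dilationDenQuad, inner_add_right, inner_smul_right]
  -- Once every inner product is a free real variable, the claim is polynomial algebra modulo the
  -- recorded relations.
  generalize inner ℝ (tangentFrame q (EuclideanSpace.single k 1))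
    (dilation a ha x : EuclideanSpace ℝ (Fin (m + 1))) = kσ at *
  generalize inner ℝ (q : EuclideanSpace ℝ (Fin (m + 1)))
    (dilation a ha x : EuclideanSpace ℝ (Fin (m + 1))) = qσ at *
  generalize inner ℝ (tangentFrame q (EuclideanSpace.single k 1))
    (x : EuclideanSpace ℝ (Fin (m + 1))) = kx at *
  generalize inner ℝ (q : EuclideanSpace ℝ (Fin (m + 1)))
    (x : EuclideanSpace ℝ (Fin (m + 1))) = qx at *
  generalize inner ℝ a (x : EuclideanSpace ℝ (Fin (m + 1))) = ax at *
  generalize inner ℝ (tangentFrame q (EuclideanSpace.single k 1)) (tangentFrame p y) = kB at *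
  generalize inner ℝ (q : EuclideanSpace ℝ (Fin (m + 1))) (tangentFrame p y) = qB at *
  generalize inner ℝ a (tangentFrame p y) = aB at *
  generalize inner ℝ (tangentFrame q (EuclideanSpace.single k 1))
    (p : EuclideanSpace ℝ (Fin (m + 1))) = kp at *
  generalize inner ℝ (q : EuclideanSpace ℝ (Fin (m + 1)))
    (p : EuclideanSpace ℝ (Fin (m + 1))) = qp at *
  generalize inner ℝ a (p : EuclideanSpace ℝ (Fin (m + 1))) = c at *
  generalize inner ℝ (tangentFrame q (EuclideanSpace.single k 1)) a = ka at *
  generalize inner ℝ (q : EuclideanSpace ℝ (Fin (m + 1))) a = qa at *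
  generalize ‖y‖ ^ 2 = r at *
  generalize ‖a‖ ^ 2 = α at *
  have hnum : (r + 4) * (1 + 2 * ax + α) * (2 * kσ)
      = 0 + (8 * (1 - α) * kB + 16 * aB * ka) + 8 * ka * r := by
    linear_combination 2 * (r + 4) * s3 + 2 * (1 - α) * i3 + 4 * ka * i1 + 2 * (4 - r) * r1
  -- The extra factor `1 + 2 * c + α` is there because `r2`, `r3` and `r4` determine the inner
  -- products with `q` only after multiplication by it.
  have hden' : (1 + 2 * c + α) * ((r + 4) * (1 + 2 * ax + α) * (1 + qσ)) = (1 + 2 * c + α) *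
      (8 * (1 + 2 * c + α) + 16 * aB + (1 + α - 2 * c - (1 - α) * qp + 2 * (1 - c) * qa) * r) := by
    linear_combination (1 + 2 * c + α) * ((r + 4) * s2 + (1 - α) * i2 + 2 * qa * i1 + 2 * i1)
      + 4 * (1 - α) * r2 + (8 * aB + 8 * (1 + c)) * r3 + 4 * (1 - α) * r4
  have hden := mul_left_cancel₀ hD0.ne' hden'
  rw [← hnum, ← hden, mul_div_mul_left _ _ (by positivity), div_mul_eq_mul_div]

theorem contDiffAt_dilationTransition {a : EuclideanSpace ℝ (Fin (m + 1))} (ha : ‖a‖ < 1)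
    (p q : UnitSphere m) :
    ContDiffAt ℝ ∞ (dilationTransition a p q) 0 := by
  have hD0 := dilation_denom_pos ha p
  have hr : ContDiff ℝ ∞ fun y : EuclideanSpace ℝ (Fin m) => ‖y‖ ^ 2 := contDiff_norm_sq ℝ
  rw [contDiffAt_euclidean]
  intro k
  refine ContDiffAt.div ?_ ?_ (by simpa using hD0.ne')
  · exact ((contDiff_const.add (dilationLin a p q k).contDiff).add
      (contDiff_const.mul hr)).contDiffAt
  · exact ((contDiff_const.add (dilationDenLin a p).contDiff).add
      (contDiff_const.mul hr)).contDiffAt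

theorem partialDeriv_dilationTransition {a : EuclideanSpace ℝ (Fin (m + 1))} (ha : ‖a‖ < 1)
    (p q : UnitSphere m) (i k : Fin m) :
    partialDeriv i (fun y => dilationTransition a p q y k) 0
      = inner ℝ (tangentFrame q (EuclideanSpace.single k 1))
          (dilationVec a p (EuclideanSpace.single i 1))
        / (8 * (1 + 2 * inner ℝ a p + ‖a‖ ^ 2)) :=
  partialDeriv_quadratic_div_zero _ _ _ _ (by have := dilation_denom_pos ha p; positivity) i

theorem partialDeriv_partialDeriv_dilationTransition {a : EuclideanSpace ℝ (Fin (m + 1))} (ha : ‖a‖ < 1)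
    (p q : UnitSphere m) (i k : Fin m) :
    partialDeriv i (partialDeriv i (fun y => dilationTransition a p q y k)) 0
      = 2 * (8 * inner ℝ (tangentFrame q (EuclideanSpace.single k 1)) a)
          / (8 * (1 + 2 * inner ℝ a p + ‖a‖ ^ 2))
        - 2 * (inner ℝ (tangentFrame q (EuclideanSpace.single k 1))
            (dilationVec a p (EuclideanSpace.single i 1))
          * (16 * inner ℝ a (tangentFrame p (EuclideanSpace.single i 1))))
          / (8 * (1 + 2 * inner ℝ a p + ‖a‖ ^ 2)) ^ 2 :=
  partialDeriv_partialDeriv_quadratic_div_zero _ _ _ _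
    (by have := dilation_denom_pos ha p; positivity) i

/-- `dilationVec` is a multiple of the differential of the dilation plus a component along `σ p`;
this computes that normal component. -/
theorem inner_dilation_dilationVec (p : UnitSphere m) (y : EuclideanSpace ℝ (Fin m)) :
    inner ℝ (dilation a ha p : EuclideanSpace ℝ (Fin (m + 1))) (dilationVec a p y)
      = 16 * inner ℝ a (tangentFrame p y) := by
  have hD := dilation_denom_pos ha p
  refine mul_left_cancel₀ hD.ne' ?_
  rw [dilationVec, inner_add_right, inner_smul_right, inner_smul_right]
  linear_combination 8 * (1 - ‖a‖ ^ 2) * inner_dilation_tangentFrame ha p y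
    + 16 * inner ℝ a (tangentFrame p y) * inner_dilation_param ha p

/-- The second summand is the product of the normal components, so what remains in the tangent space
is a multiple of the Euclidean product: this is the conformality of the dilation. -/
theorem inner_dilationVec (p : UnitSphere m) (y z : EuclideanSpace ℝ (Fin m)) :
    inner ℝ (dilationVec a p y) (dilationVec a p z)
      = 64 * (1 - ‖a‖ ^ 2) ^ 2 * inner ℝ y z
        + 256 * inner ℝ a (tangentFrame p y) * inner ℝ a (tangentFrame p z) := by
  simp only [dilationVec, inner_add_left, inner_add_right, inner_smul_left, inner_smul_right,
    inner_tangentFrame, real_inner_self_eq_norm_sq, real_inner_comm a (tangentFrame p y)]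
  simp
  ring

theorem sum_partialDeriv_dilationTransition (p : UnitSphere m) (k l : Fin m) :
    ∑ i, partialDeriv i (fun y => dilationTransition a p (dilation a ha p) y k) 0
        * partialDeriv i (fun y => dilationTransition a p (dilation a ha p) y l) 0
      = ((1 - ‖a‖ ^ 2) / (1 + 2 * inner ℝ a p + ‖a‖ ^ 2)) ^ 2
        * (1 : Matrix (Fin m) (Fin m) ℝ) k l := by
  have hD := dilation_denom_pos ha p
  have hα := one_sub_normSq_pos ha
  set lam := (1 - ‖a‖ ^ 2) / (1 + 2 * inner ℝ a p + ‖a‖ ^ 2) with hlam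
  have hlam0 : lam ^ 2 ≠ 0 := by positivity
  let S : Matrix (Fin m) (Fin m) ℝ := Matrix.of fun i k =>
    partialDeriv i (fun y => dilationTransition a p (dilation a ha p) y k) 0
  have h1 : S * S.transpose = lam ^ 2 • (1 : Matrix (Fin m) (Fin m) ℝ) := by
    ext i j
    simp only [Matrix.mul_apply, Matrix.transpose_apply, S, Matrix.of_apply,
      partialDeriv_dilationTransition ha, div_mul_div_comm]
    rw [← Finset.sum_div, sum_inner_tangentFrame, inner_dilation_dilationVec,
      inner_dilation_dilationVec, inner_dilationVec, EuclideanSpace.inner_single_left]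
    simp only [Matrix.smul_apply, Matrix.one_apply, smul_eq_mul, hlam]
    by_cases hij : i = j
    · subst hij
      simp
      field_simp
      ring
    · simp [hij]
      left
      ring
  -- Parseval gives `S Sᵀ`, while the traces need `Sᵀ S`; for square matrices a one-sided inverse is
  -- two-sided.
  have h2 : (lam ^ 2)⁻¹ • S * S.transpose = 1 := by
    rw [Matrix.smul_mul, h1, smul_smul, inv_mul_cancel₀ hlam0, one_smul]
  have h3 := mul_eq_one_comm.1 h2
  rw [Matrix.mul_smul] at h3
  have h4 : S.transpose * S = lam ^ 2 • (1 : Matrix (Fin m) (Fin m) ℝ) := by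
    rw [← h3, smul_smul, mul_inv_cancel₀ hlam0, one_smul]
  have h5 := congrFun (congrFun h4 k) l
  simpa [Matrix.mul_apply, S] using h5

/-- These are the components of the tension field of the dilation. With `D` the denominator, the
quadratic numerator gives `2m/D` and the cross term, summed by Parseval, gives `-4/D`. -/
theorem sum_partialDeriv_partialDeriv_dilationTransition (p : UnitSphere m) (k : Fin m) :
    ∑ i, partialDeriv i (partialDeriv i
        (fun y => dilationTransition a p (dilation a ha p) y k)) 0
      = (2 * m - 4) / (1 + 2 * inner ℝ a p + ‖a‖ ^ 2)
        * inner ℝ (tangentFrame (dilation a ha p) (EuclideanSpace.single k 1)) a := by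
  have hD := dilation_denom_pos ha p
  simp only [partialDeriv_partialDeriv_dilationTransition ha]
  rw [Finset.sum_sub_distrib, ← Finset.sum_div, ← Finset.sum_div]
  set e := tangentFrame (dilation a ha p) (EuclideanSpace.single k 1) with he
  have h1 : ∑ i, 2 * (inner ℝ e (dilationVec a p (EuclideanSpace.single i 1))
          * (16 * inner ℝ a (tangentFrame p (EuclideanSpace.single i 1))))
      = 32 * (8 * (1 - ‖a‖ ^ 2) * ∑ i, inner ℝ (tangentFrame p (EuclideanSpace.single i 1)) e
          * inner ℝ (tangentFrame p (EuclideanSpace.single i 1)) a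
        + 16 * inner ℝ e a * ∑ i, inner ℝ (tangentFrame p (EuclideanSpace.single i 1)) a
          * inner ℝ (tangentFrame p (EuclideanSpace.single i 1)) a) := by
    rw [Finset.mul_sum, Finset.mul_sum, ← Finset.sum_add_distrib, Finset.mul_sum]
    refine Finset.sum_congr rfl fun i _ => ?_
    rw [dilationVec, inner_add_right, inner_smul_right, inner_smul_right,
      real_inner_comm e (tangentFrame p (EuclideanSpace.single i 1)),
      real_inner_comm a (tangentFrame p (EuclideanSpace.single i 1))]
    ring
  have r1 := inner_tangentFrame_dilation ha p (EuclideanSpace.single k 1)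
  rw [← he] at r1
  rw [h1, sum_inner_tangentFrame, sum_inner_tangentFrame, real_inner_self_eq_norm_sq]
  simp only [Finset.sum_const, Finset.card_univ, Fintype.card_fin, nsmul_eq_mul]
  rw [real_inner_comm e (p : EuclideanSpace ℝ (Fin (m + 1))),
    real_inner_comm a (p : EuclideanSpace ℝ (Fin (m + 1)))]
  obtain ⟨D, hDdef⟩ : ∃ D, D = 1 + 2 * inner ℝ a (p : EuclideanSpace ℝ (Fin (m + 1))) + ‖a‖ ^ 2 :=
    ⟨_, rfl⟩
  rw [← hDdef] at hD ⊢
  have h2 : 32 * (8 * (1 - ‖a‖ ^ 2) * (inner ℝ e a - inner ℝ e (p : EuclideanSpace ℝ (Fin (m + 1)))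
        * inner ℝ a (p : EuclideanSpace ℝ (Fin (m + 1))))
      + 16 * inner ℝ e a * (‖a‖ ^ 2 - inner ℝ a (p : EuclideanSpace ℝ (Fin (m + 1)))
        * inner ℝ a (p : EuclideanSpace ℝ (Fin (m + 1))))) = 256 * D * inner ℝ e a := by
    rw [hDdef]
    linear_combination -256 * inner ℝ a (p : EuclideanSpace ℝ (Fin (m + 1))) * r1
  rw [h2]
  field_simp
  ring

theorem sum_sq_laplacian_dilationTransition_le (p : UnitSphere m) :
    ∑ k, (∑ i, partialDeriv i (partialDeriv i
        (fun y => dilationTransition a p (dilation a ha p) y k)) 0) ^ 2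
      ≤ (2 * m - 4) ^ 2 * ((1 - ‖a‖ ^ 2) ^ 2 / (1 + 2 * inner ℝ a p + ‖a‖ ^ 2) ^ 3) := by
  have hD := dilation_denom_pos ha p
  simp only [sum_partialDeriv_partialDeriv_dilationTransition, mul_pow]
  rw [← Finset.mul_sum]
  have h1 : ∑ k, inner ℝ (tangentFrame (dilation a ha p) (EuclideanSpace.single k 1)) a ^ 2
      = (1 - ‖a‖ ^ 2) ^ 2 * (‖a‖ ^ 2 - inner ℝ a p ^ 2)
        / (1 + 2 * inner ℝ a p + ‖a‖ ^ 2) ^ 2 := by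
    simp only [pow_two (inner ℝ (tangentFrame _ _) a)]
    rw [sum_inner_tangentFrame, real_inner_self_eq_norm_sq,
      eq_div_of_mul_eq hD.ne' ((mul_comm _ _).trans (inner_dilation_param ha p))]
    obtain ⟨D, hDdef⟩ : ∃ D, D = 1 + 2 * inner ℝ a (p : EuclideanSpace ℝ (Fin (m + 1))) + ‖a‖ ^ 2 :=
      ⟨_, rfl⟩
    rw [← hDdef] at hD ⊢
    field_simp
    rw [hDdef]
    ring
  -- The difference of the two sides is `(1 + ⟨a,p⟩)²`; this saves one power of the denominator.
  have h2 : ‖a‖ ^ 2 - inner ℝ a p ^ 2 ≤ 1 + 2 * inner ℝ a p + ‖a‖ ^ 2 := by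
    nlinarith [sq_nonneg (1 + inner ℝ a (p : EuclideanSpace ℝ (Fin (m + 1))))]
  rw [h1]
  generalize 1 + 2 * inner ℝ a (p : EuclideanSpace ℝ (Fin (m + 1))) + ‖a‖ ^ 2 = D at *
  calc _ = (2 * (m : ℝ) - 4) ^ 2 * ((1 - ‖a‖ ^ 2) ^ 2 * (‖a‖ ^ 2 - inner ℝ a p ^ 2) / D ^ 4) := by
        field_simp
    _ ≤ (2 * (m : ℝ) - 4) ^ 2 * ((1 - ‖a‖ ^ 2) ^ 2 * D / D ^ 4) := by gcongr
    _ = _ := by field_simp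

end DilationTransition

/-! ### The radial retraction onto the sphere. -/

section RadialRetraction

variable {m : ℕ}

open Classical in
/-- The radial retraction of the punctured ambient space onto the unit sphere, with an arbitrary
value at the origin. -/
def radialRetraction (x : EuclideanSpace ℝ (Fin (m + 1))) : UnitSphere m :=
  if hx : x = 0 then ⟨EuclideanSpace.single 0 1, by simp⟩
  else ⟨‖x‖⁻¹ • x, by simp [norm_smul, hx]⟩

theorem coe_radialRetraction {x : EuclideanSpace ℝ (Fin (m + 1))} (hx : x ≠ 0) :
    (radialRetraction x : EuclideanSpace ℝ (Fin (m + 1))) = ‖x‖⁻¹ • x := by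
  simp [radialRetraction, hx]

theorem radialRetraction_sphere (x : UnitSphere m) :
    radialRetraction (x : EuclideanSpace ℝ (Fin (m + 1))) = x := by
  ext1
  rw [coe_radialRetraction (ne_zero_of_mem_unit_sphere x), norm_eq_of_mem_sphere, inv_one, one_smul]

theorem contDiffAt_coe_radialRetraction {x : EuclideanSpace ℝ (Fin (m + 1))} (hx : x ≠ 0) :
    ContDiffAt ℝ ∞ (fun z => (radialRetraction z : EuclideanSpace ℝ (Fin (m + 1)))) x := by
  have h1 : ContDiffAt ℝ ∞ (fun z : EuclideanSpace ℝ (Fin (m + 1)) => ‖z‖⁻¹ • z) x :=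
    ((contDiffAt_norm ℝ hx).inv (norm_ne_zero_iff.2 hx)).smul contDiffAt_id
  refine h1.congr_of_eventuallyEq ?_
  filter_upwards [isOpen_ne.mem_nhds hx] with z hz using coe_radialRetraction hz

theorem contMDiffAt_radialRetraction {x : EuclideanSpace ℝ (Fin (m + 1))} (hx : x ≠ 0) :
    ContMDiffAt 𝓘(ℝ, EuclideanSpace ℝ (Fin (m + 1))) (𝓡 m) ∞
      (radialRetraction : EuclideanSpace ℝ (Fin (m + 1)) → UnitSphere m) x := by
  have h1 := contDiffAt_coe_radialRetraction hx
  rw [contMDiffAt_iff_target]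
  refine ⟨Topology.IsInducing.subtypeVal.continuousAt_iff.2 h1.continuousAt, ?_⟩
  set q := radialRetraction x
  refine ContDiffAt.contMDiffAt (contDiffAt_euclidean.2 fun k => ?_)
  have h2 : (fun z => ((extChartAt (𝓡 m) q ∘ radialRetraction) z : EuclideanSpace ℝ (Fin m)) k)
      = fun z => 2 / (1 + inner ℝ (q : EuclideanSpace ℝ (Fin (m + 1))) (radialRetraction z))
        * inner ℝ (tangentFrame q (EuclideanSpace.single k 1))
          (radialRetraction z : EuclideanSpace ℝ _) :=
    funext fun z => extChartAt_sphere_apply q (radialRetraction z) k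
  rw [h2]
  have h3 : 1 + inner ℝ (q : EuclideanSpace ℝ (Fin (m + 1))) (radialRetraction x) ≠ 0 := by
    rw [inner_self_sphere q]; norm_num
  exact (contDiffAt_const.div (contDiffAt_const.add (contDiffAt_const.inner ℝ h1)) h3).mul
    (contDiffAt_const.inner ℝ h1)

end RadialRetraction

/-! ### Boundedness of the energy density of a smooth map. -/

section EnergyDensityBound

variable {m n : ℕ} {N : Type*} [TopologicalSpace N] [ChartedSpace (EuclideanSpace ℝ (Fin n)) N]
  [IsManifold (𝓡 n) ∞ N]

theorem SmoothMetric.continuous_inner_self (h : SmoothMetric n N) :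
    Continuous fun v : TangentBundle (𝓡 n) N => h.inner v.1 v.2 v.2 := by
  rw [continuous_iff_continuousAt]
  intro v
  have hproj : Continuous (fun v : TangentBundle (𝓡 n) N => v.1) :=
    FiberBundle.continuous_proj _ _
  have h1 : ContinuousAt (fun v : TangentBundle (𝓡 n) N =>
      TotalSpace.mk' ℝ (E := Bundle.Trivial N ℝ) v.1 (h.inner v.1 v.2 v.2)) v :=
    (h.contMDiff.continuous.continuousAt.comp hproj.continuousAt).clm_bundle_apply₂
      (F₁ := EuclideanSpace ℝ (Fin n)) (F₂ := EuclideanSpace ℝ (Fin n))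
      continuousAt_id continuousAt_id
  simp only [FiberBundle.continuousAt_totalSpace] at h1
  exact h1.2

theorem exists_inner_mfderiv_le (h : SmoothMetric n N) {F : Type*} [NormedAddCommGroup F]
    [NormedSpace ℝ F] {f : F → N} {U : Set F} (hU : IsOpen U)
    (hf : ContMDiffOn 𝓘(ℝ, F) (𝓡 n) ∞ f U) {K : Set (F × F)} (hK : IsCompact K)
    (hKU : ∀ z ∈ K, z.1 ∈ U) :
    ∃ C, ∀ z ∈ K, h.inner (f z.1) (mfderiv 𝓘(ℝ, F) (𝓡 n) f z.1 z.2)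
      (mfderiv 𝓘(ℝ, F) (𝓡 n) f z.1 z.2) ≤ C := by
  have : IsManifold (𝓡 n) 1 N := IsManifold.of_le (n := ∞) (by simp)
  have h1 := hf.continuousOn_tangentMapWithin (by simp) hU.uniqueMDiffOn
  have h2 := (SmoothMetric.continuous_inner_self h).comp_continuousOn h1
  have h3 : Continuous fun z : F × F => (⟨z.1, z.2⟩ : TangentBundle 𝓘(ℝ, F) F) :=
    (tangentBundleModelSpaceHomeomorph 𝓘(ℝ, F)).symm.continuous
  have h4 := h2.comp (h3.continuousOn (s := K)) fun z hz => hKU z hz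
  obtain ⟨C, hC⟩ := (hK.image_of_continuousOn h4).bddAbove
  refine ⟨C, fun z hz => ?_⟩
  have h5 := hC (Set.mem_image_of_mem _ hz)
  have h6 : mfderivWithin 𝓘(ℝ, F) (𝓡 n) f U z.1 = mfderiv 𝓘(ℝ, F) (𝓡 n) f z.1 :=
    mfderivWithin_of_isOpen hU (hKU z hz)
  simp only [Function.comp_apply, tangentMapWithin] at h5
  rw [h6] at h5
  exact h5

theorem fderiv_stereoParam_zero (q : UnitSphere m) (v : EuclideanSpace ℝ (Fin m)) :
    fderiv ℝ (stereoParam q) 0 v = tangentFrame q v := by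
  rw [(hasFDerivAt_stereoParam q 0).fderiv]
  simp

/-- The left side uses charts that change with `q`, so its dependence on `q` is opaque. The right
side is the derivative of one fixed map on the punctured ambient space, to which continuity and
compactness apply. -/
theorem differentialVec_eq (φ : C^∞⟮𝓡 m, UnitSphere m; 𝓡 n, N⟯) (q : UnitSphere m) (i : Fin m) :
    (differentialVec φ q i : EuclideanSpace ℝ (Fin n))
      = mfderiv 𝓘(ℝ, EuclideanSpace ℝ (Fin (m + 1))) (𝓡 n) (φ ∘ radialRetraction)
        (q : EuclideanSpace ℝ (Fin (m + 1))) (tangentFrame q (EuclideanSpace.single i 1)) := by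
  let F : EuclideanSpace ℝ (Fin m) → EuclideanSpace ℝ (Fin n) :=
    writtenInExtChartAt (𝓡 m) (𝓡 n) q φ
  let G : EuclideanSpace ℝ (Fin n) → N := (extChartAt (𝓡 n) (φ q)).symm
  let Φ : EuclideanSpace ℝ (Fin (m + 1)) → N := φ ∘ radialRetraction
  have hq0 : (extChartAt (𝓡 m) q).symm (0 : EuclideanSpace ℝ (Fin m)) = q := by
    rw [← extChartAt_sphere_self q, extChartAt_to_inv]
  have hF0 : F 0 = extChartAt (𝓡 n) (φ q) (φ q) := by
    simp only [F, writtenInExtChartAt, Function.comp_apply, hq0]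
  have hF : ContDiffAt ℝ ∞ F 0 := by
    rw [contDiffAt_euclidean]
    exact contDiffAt_mapCoord φ q
  have hG : MDifferentiableAt 𝓘(ℝ, EuclideanSpace ℝ (Fin n)) (𝓡 n) G (F 0) := by
    rw [hF0]
    have h1 : ContMDiffAt 𝓘(ℝ, EuclideanSpace ℝ (Fin n)) (𝓡 n) ∞ G
        (extChartAt (𝓡 n) (φ q) (φ q)) :=
      (contMDiffOn_extChartAt_symm (φ q)).contMDiffAt (extChartAt_target_mem_nhds (φ q))
    exact h1.mdifferentiableAt (by simp)
  have hΦ : MDifferentiableAt 𝓘(ℝ, EuclideanSpace ℝ (Fin (m + 1))) (𝓡 n) Φ (stereoParam q 0) := by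
    rw [stereoParam_zero]
    exact ((φ.contMDiff _).comp _ (contMDiffAt_radialRetraction
      (ne_zero_of_mem_unit_sphere q))).mdifferentiableAt (by simp)
  have heq : G ∘ F =ᶠ[nhds 0] Φ ∘ stereoParam q := by
    have hc : Continuous fun y => φ ((extChartAt (𝓡 m) q).symm y) :=
      φ.contMDiff.continuous.comp (contMDiff_extChartAt_sphere_symm q).continuous
    have h3 := hc.continuousAt (x := 0) |>.preimage_mem_nhds
      (t := (extChartAt (𝓡 n) (φ q)).source) (by
        rw [hq0]; exact extChartAt_source_mem_nhds (φ q))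
    filter_upwards [h3] with y hy
    have h4 := (extChartAt (𝓡 n) (φ q)).left_inv hy
    simp only [Function.comp_apply, Φ, ← extChartAt_sphere_symm_apply, radialRetraction_sphere]
    exact h4
  have h1 := hG.hasMFDerivAt.comp 0 (hF.differentiableAt (by simp)).hasFDerivAt.hasMFDerivAt
  have h2 := hΦ.hasMFDerivAt.comp 0
    (hasFDerivAt_stereoParam q 0).differentiableAt.hasFDerivAt.hasMFDerivAt
  have h3 := hasMFDerivAt_unique h1 (h2.congr_of_eventuallyEq heq)
  -- The base points agree only propositionally; quantifying over them allows the substitution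
  -- inside the dependent tangent spaces.
  have h4 : ∀ (y : EuclideanSpace ℝ (Fin n)) (x : EuclideanSpace ℝ (Fin (m + 1))),
      y = F 0 → x = stereoParam q 0 → ∀ v : EuclideanSpace ℝ (Fin m),
      (mfderiv 𝓘(ℝ, EuclideanSpace ℝ (Fin n)) (𝓡 n) G y (fderiv ℝ F 0 v) :
        EuclideanSpace ℝ (Fin n))
      = mfderiv 𝓘(ℝ, EuclideanSpace ℝ (Fin (m + 1))) (𝓡 n) Φ x (fderiv ℝ (stereoParam q) 0 v) := by
    rintro _ _ rfl rfl v
    exact congrArg (fun A : EuclideanSpace ℝ (Fin m) →L[ℝ] EuclideanSpace ℝ (Fin n) => A v) h3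
  have h5 := h4 _ _ hF0.symm (stereoParam_zero q).symm (EuclideanSpace.single i 1)
  rw [fderiv_stereoParam_zero] at h5
  refine Eq.trans ?_ h5
  have h6 : fderiv ℝ F 0 (EuclideanSpace.single i 1)
      = ∑ a, partialDeriv i (mapCoord (m := m) (n := n) φ q a) 0
        • EuclideanSpace.single a (1 : ℝ) := by
    have h7 := (EuclideanSpace.basisFun (Fin n) ℝ).sum_repr
      (fderiv ℝ F 0 (EuclideanSpace.single i 1))
    rw [← h7]
    refine Finset.sum_congr rfl fun a _ => ?_
    have h8 := ((EuclideanSpace.proj a : EuclideanSpace ℝ (Fin n) →L[ℝ] ℝ).hasFDerivAt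
      (x := F 0)).comp 0 (hF.differentiableAt (by simp)).hasFDerivAt
    have h9 : partialDeriv i (mapCoord (m := m) (n := n) φ q a) 0
        = fderiv ℝ F 0 (EuclideanSpace.single i 1) a :=
      congrArg (fun A : EuclideanSpace ℝ (Fin m) →L[ℝ] ℝ => A (EuclideanSpace.single i 1))
        h8.fderiv
    rw [h9]
    simp
  rw [h6]
  exact (map_sum (mfderiv 𝓘(ℝ, EuclideanSpace ℝ (Fin n)) (𝓡 n) G
    (extChartAt (𝓡 n) (φ q) (φ q))) _ _ |>.trans (Finset.sum_congr rfl fun a _ =>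
      map_smul (mfderiv 𝓘(ℝ, EuclideanSpace ℝ (Fin n)) (𝓡 n) G
        (extChartAt (𝓡 n) (φ q) (φ q))) _ _)).symm

/-- The pairs (point, frame vector) lie in the compact product of two unit spheres, on which the
squared length of the derivative is bounded. -/
theorem exists_differentialNormSq_le (h : SmoothMetric n N)
    (φ : C^∞⟮𝓡 m, UnitSphere m; 𝓡 n, N⟯) :
    ∃ C, ∀ q, differentialNormSq (sphereMetric m) h φ q ≤ C := by
  have hf : ContMDiffOn 𝓘(ℝ, EuclideanSpace ℝ (Fin (m + 1))) (𝓡 n) ∞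
      (φ ∘ radialRetraction) {0}ᶜ := fun x hx =>
    ((φ.contMDiff _).comp x (contMDiffAt_radialRetraction hx)).contMDiffWithinAt
  obtain ⟨C, hC⟩ := exists_inner_mfderiv_le h isOpen_compl_singleton hf
    ((isCompact_sphere (0 : EuclideanSpace ℝ (Fin (m + 1))) 1).prod
      (isCompact_sphere (0 : EuclideanSpace ℝ (Fin (m + 1))) 1))
    (fun z hz => ne_zero_of_mem_unit_sphere ⟨z.1, hz.1⟩)
  refine ⟨m * C, fun q => ?_⟩
  rw [differentialNormSq_eq_sum_inner]
  have h1 : ∀ i ∈ Finset.univ, h.inner _ (differentialVec φ q i) (differentialVec φ q i) ≤ C := by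
    intro i _
    refine le_trans (le_of_eq ?_) (hC ((q : EuclideanSpace ℝ (Fin (m + 1))),
      tangentFrame q (EuclideanSpace.single i 1)) ⟨q.2, by simp⟩)
    have h2 : ∀ (x y : N) (v w : EuclideanSpace ℝ (Fin n)), x = y → v = w →
        h.inner x v v = h.inner y w w := by
      rintro x _ v _ rfl rfl
      rfl
    refine h2 _ _ _ _ ?_ (differentialVec_eq φ q i)
    rw [Function.comp_apply, radialRetraction_sphere]
    exact extChartAt_to_inv _
  simpa using Finset.sum_le_card_nsmul _ _ _ h1

end EnergyDensityBound

/-! ### Measure of polar caps, integrability of the majorant, dominated convergence. -/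

section PolarCaps

open scoped Pointwise

variable {m : ℕ}

/-- The union of the two polar caps of radius `r` around the first coordinate axis. -/
def polarCaps (m : ℕ) (r : ℝ) : Set (UnitSphere m) :=
  {x | 1 - (x : EuclideanSpace ℝ (Fin (m + 1))) 0 ^ 2 ≤ r ^ 2}

theorem measurable_sphere_coord (i : Fin (m + 1)) :
    Measurable fun x : UnitSphere m => (x : EuclideanSpace ℝ (Fin (m + 1))) i :=
  ((EuclideanSpace.proj i : EuclideanSpace ℝ (Fin (m + 1)) →L[ℝ] ℝ).continuous.comp
    continuous_subtype_val).measurable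

theorem measurableSet_polarCaps (r : ℝ) : MeasurableSet (polarCaps m r) :=
  measurableSet_le (measurable_const.sub ((measurable_sphere_coord 0).pow_const 2))
    measurable_const

theorem sum_sq_sphere (x : UnitSphere m) :
    (x : EuclideanSpace ℝ (Fin (m + 1))) 0 ^ 2
      + ∑ i : Fin m, (x : EuclideanSpace ℝ (Fin (m + 1))) i.succ ^ 2 = 1 := by
  have h := EuclideanSpace.real_norm_sq_eq (x : EuclideanSpace ℝ (Fin (m + 1)))
  rw [norm_eq_of_mem_sphere, Fin.sum_univ_succ] at h
  linarith

theorem volume_box_le (b : Fin (m + 1) → ℝ) :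
    (volume : Measure (EuclideanSpace ℝ (Fin (m + 1)))) {z | ∀ i, |z i| ≤ b i}
      = ∏ i, ENNReal.ofReal (2 * b i) := by
  have h1 : {z : EuclideanSpace ℝ (Fin (m + 1)) | ∀ i, |z i| ≤ b i}
      = WithLp.ofLp ⁻¹' (Set.Icc (-b) b) := by
    ext z
    simp [abs_le, Pi.le_def, forall_and]
  rw [h1, (PiLp.volume_preserving_ofLp (Fin (m + 1))).measure_preimage
    measurableSet_Icc.nullMeasurableSet, Real.volume_Icc_pi]
  exact Finset.prod_congr rfl fun i _ => by rw [Pi.neg_apply]; ring_nf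

/-- The surface measure is `m + 1` times the volume of the cone over the set, and that cone lies in
a box with one side `2` and `m` sides `2r`. -/
theorem sphereVolume_polarCaps_le {r : ℝ} (hr : 0 ≤ r) :
    sphereVolume m (polarCaps m r) ≤ ENNReal.ofReal ((m + 1) * 2 * 2 ^ m * r ^ m) := by
  rw [sphereVolume, Measure.toSphere_apply' _ (measurableSet_polarCaps r), finrank_euclideanSpace_fin]
  have h1 : (Set.Ioo (0 : ℝ) 1 • (Subtype.val '' polarCaps m r) :
      Set (EuclideanSpace ℝ (Fin (m + 1))))
      ⊆ {z | ∀ i, |z i| ≤ (Fin.cons 1 (fun _ => r) : Fin (m + 1) → ℝ) i} := by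
    rintro _ ⟨t, ht, _, ⟨x, hx, rfl⟩, rfl⟩ i
    have hs := sum_sq_sphere x
    have hx' : 1 - (x : EuclideanSpace ℝ (Fin (m + 1))) 0 ^ 2 ≤ r ^ 2 := hx
    have hn : ∀ j : Fin m, (x : EuclideanSpace ℝ (Fin (m + 1))) j.succ ^ 2
        ≤ ∑ i : Fin m, (x : EuclideanSpace ℝ (Fin (m + 1))) i.succ ^ 2 := fun j =>
      Finset.single_le_sum (f := fun i : Fin m => (x : EuclideanSpace ℝ (Fin (m + 1))) i.succ ^ 2)
        (fun i _ => sq_nonneg _) (Finset.mem_univ j)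
    have ht' : ∀ u : ℝ, |t * u| ≤ |u| := fun u => by
      rw [abs_mul, abs_of_pos ht.1]
      exact mul_le_of_le_one_left (abs_nonneg _) ht.2.le
    refine (ht' _).trans ?_
    refine Fin.cases ?_ (fun j => ?_) i
    · rw [Fin.cons_zero]
      refine abs_le_of_sq_le_sq ?_ zero_le_one
      have : 0 ≤ ∑ i : Fin m, (x : EuclideanSpace ℝ (Fin (m + 1))) i.succ ^ 2 :=
        Finset.sum_nonneg fun i _ => sq_nonneg _
      change (x : EuclideanSpace ℝ (Fin (m + 1))) 0 ^ 2 ≤ 1 ^ 2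
      linarith
    · rw [Fin.cons_succ]
      refine abs_le_of_sq_le_sq ?_ hr
      change (x : EuclideanSpace ℝ (Fin (m + 1))) j.succ ^ 2 ≤ r ^ 2
      linarith [hn j]
  refine (mul_le_mul_right (measure_mono h1) _).trans (le_of_eq ?_)
  rw [volume_box_le, Fin.prod_univ_succ]
  simp only [Fin.cons_zero, Fin.cons_succ, Finset.prod_const, Finset.card_univ, Fintype.card_fin]
  rw [← ENNReal.ofReal_pow (by positivity), ← ENNReal.ofReal_mul (by norm_num),
    ← ENNReal.ofReal_natCast, ← ENNReal.ofReal_mul (by positivity)]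
  congr 1
  push_cast
  ring

theorem isFiniteMeasure_sphereVolume : IsFiniteMeasure (sphereVolume m) := by
  unfold sphereVolume
  infer_instance

theorem ae_one_sub_coord_sq_pos (hm : 0 < m) :
    ∀ᵐ x : UnitSphere m ∂(sphereVolume m), 0 < 1 - (x : EuclideanSpace ℝ (Fin (m + 1))) 0 ^ 2 := by
  have h1 : sphereVolume m (polarCaps m 0) = 0 := by
    refine le_antisymm ((sphereVolume_polarCaps_le le_rfl).trans (le_of_eq ?_)) zero_le
    simp [hm.ne']
  filter_upwards [measure_eq_zero_iff_ae_notMem.1 h1] with x hx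
  simpa [polarCaps] using hx

theorem measurable_inv_one_sub_coord_sq :
    Measurable fun x : UnitSphere m =>
      ((1 - (x : EuclideanSpace ℝ (Fin (m + 1))) 0 ^ 2) ^ 2)⁻¹ := by
  have h1 : Measurable fun x : UnitSphere m => 1 - (x : EuclideanSpace ℝ (Fin (m + 1))) 0 ^ 2 :=
    measurable_const.sub ((measurable_sphere_coord 0).pow_const 2)
  exact (h1.pow_const 2).inv

/-- Layer cake: the set where the integrand exceeds `t` lies in the caps of radius `t^(-1/4)`, of
measure `O(t^(-m/4))`. This is integrable at infinity because `m > 4`. -/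
theorem lintegral_inv_one_sub_coord_sq_lt_top (hm : 5 ≤ m) :
    ∫⁻ x : UnitSphere m, ENNReal.ofReal (((1 - (x : EuclideanSpace ℝ (Fin (m + 1))) 0 ^ 2) ^ 2)⁻¹)
      ∂(sphereVolume m) < ⊤ := by
  have := isFiniteMeasure_sphereVolume (m := m)
  rw [lintegral_eq_lintegral_meas_lt _ (Filter.Eventually.of_forall fun x => by positivity)
    measurable_inv_one_sub_coord_sq.aemeasurable,
    ← Set.Ioc_union_Ioi_eq_Ioi zero_le_one]
  refine (lintegral_union_le _ _ _).trans_lt (ENNReal.add_lt_top.2 ⟨?_, ?_⟩)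
  · calc _ ≤ ∫⁻ _ in Set.Ioc (0 : ℝ) 1, sphereVolume m Set.univ :=
          lintegral_mono fun t => measure_mono (Set.subset_univ _)
      _ < ⊤ := by
        rw [setLIntegral_const]
        exact ENNReal.mul_lt_top (measure_lt_top _ _) (by simp)
  · have hi : IntegrableOn (fun t : ℝ => ((m + 1) * 2 * 2 ^ m : ℝ) * t ^ (-(m : ℝ) / 4))
        (Set.Ioi 1) :=
      (integrableOn_Ioi_rpow_of_lt (by
        have : (5 : ℝ) ≤ m := by exact_mod_cast hm
        linarith) one_pos).const_mul _
    refine lt_of_le_of_lt (setLIntegral_mono_ae' measurableSet_Ioi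
      (Filter.Eventually.of_forall fun t ht => ?_)) hi.lintegral_lt_top
    have ht0 : (0 : ℝ) < t := zero_lt_one.trans ht
    have hsub : {x : UnitSphere m |
        t < ((1 - (x : EuclideanSpace ℝ (Fin (m + 1))) 0 ^ 2) ^ 2)⁻¹}
        ⊆ polarCaps m (t ^ (-(1 : ℝ) / 4)) := by
      intro x hx
      have hx' : t < ((1 - (x : EuclideanSpace ℝ (Fin (m + 1))) 0 ^ 2) ^ 2)⁻¹ := hx
      have h1 : (1 - (x : EuclideanSpace ℝ (Fin (m + 1))) 0 ^ 2) ^ 2 < t⁻¹ := by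
        refine lt_inv_of_lt_inv₀ ht0 hx'
      have h2 : ((t ^ (-(1 : ℝ) / 4)) ^ 2) ^ 2 = t⁻¹ := by
        rw [← pow_mul, ← Real.rpow_natCast, ← Real.rpow_mul ht0.le, ← Real.rpow_neg_one]
        norm_num
      rw [← h2] at h1
      exact (le_abs_self _).trans (abs_lt_of_sq_lt_sq h1 (by positivity)).le
    refine (measure_mono hsub).trans ((sphereVolume_polarCaps_le (by positivity)).trans
      (le_of_eq ?_))
    rw [← Real.rpow_natCast (t ^ _), ← Real.rpow_mul ht0.le]
    have h3 : -(1 : ℝ) / 4 * m = -(m : ℝ) / 4 := by ring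
    rw [h3]

theorem integrable_inv_one_sub_coord_sq (hm : 5 ≤ m) :
    Integrable (fun x : UnitSphere m =>
      ((1 - (x : EuclideanSpace ℝ (Fin (m + 1))) 0 ^ 2) ^ 2)⁻¹) (sphereVolume m) := by
  refine ⟨measurable_inv_one_sub_coord_sq.aestronglyMeasurable, ?_⟩
  rw [hasFiniteIntegral_iff_ofReal (Filter.Eventually.of_forall fun x => by positivity)]
  exact lintegral_inv_one_sub_coord_sq_lt_top hm

/-- The function that bounds the energy density of the conformal dilation with parameter `s` in
the direction of the first coordinate axis. -/
def dilationDensity (s : ℝ) (x : UnitSphere m) : ℝ :=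
  (1 - s ^ 2) ^ 2 / (1 + 2 * (s * (x : EuclideanSpace ℝ (Fin (m + 1))) 0) + s ^ 2) ^ 3

theorem measurable_dilationDensity (s : ℝ) : Measurable (dilationDensity (m := m) s) :=
  measurable_const.div (((measurable_const.add (((measurable_sphere_coord
    0).const_mul s).const_mul 2)).add measurable_const).pow_const 3)

theorem dilationDensity_nonneg_and_le {s : ℝ} (hs0 : 0 ≤ s) (hs1 : s < 1) {x : UnitSphere m}
    (hx : 0 < 1 - (x : EuclideanSpace ℝ (Fin (m + 1))) 0 ^ 2) :
    0 ≤ dilationDensity s x ∧ dilationDensity s x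
      ≤ 4 * ((1 - (x : EuclideanSpace ℝ (Fin (m + 1))) 0 ^ 2) ^ 2)⁻¹ := by
  rw [dilationDensity]
  generalize (x : EuclideanSpace ℝ (Fin (m + 1))) 0 = u at *
  have hu : -1 < u := by nlinarith
  have hD1 : 1 - u ^ 2 ≤ 1 + 2 * (s * u) + s ^ 2 := by nlinarith [sq_nonneg (u + s)]
  -- The difference is `2s(1 + u)`. This bound absorbs the numerator into one power of the
  -- denominator; `hD1` controls the two powers left.
  have hD2 : (1 - s) ^ 2 ≤ 1 + 2 * (s * u) + s ^ 2 := by nlinarith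
  generalize 1 + 2 * (s * u) + s ^ 2 = D at *
  have hD : 0 < D := hx.trans_le hD1
  refine ⟨by positivity, ?_⟩
  have h1 : (1 - s ^ 2) ^ 2 ≤ 4 * D := by
    have : (1 - s ^ 2) ^ 2 = (1 - s) ^ 2 * (1 + s) ^ 2 := by ring
    rw [this, mul_comm]
    exact mul_le_mul (by nlinarith) hD2 (sq_nonneg _) (by norm_num)
  calc (1 - s ^ 2) ^ 2 / D ^ 3 ≤ 4 * D / D ^ 3 := by gcongr
    _ = 4 * (D ^ 2)⁻¹ := by field_simp
    _ ≤ _ := by gcongr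

theorem integrable_dilationDensity (hm : 5 ≤ m) {s : ℝ} (hs0 : 0 ≤ s) (hs1 : s < 1) :
    Integrable (dilationDensity (m := m) s) (sphereVolume m) := by
  refine ((integrable_inv_one_sub_coord_sq hm).const_mul 4).mono'
    (measurable_dilationDensity s).aestronglyMeasurable ?_
  filter_upwards [ae_one_sub_coord_sq_pos (m := m) (by lia)] with x hx
  have h := dilationDensity_nonneg_and_le hs0 hs1 hx
  rw [Real.norm_of_nonneg h.1]
  exact h.2

theorem tendsto_integral_dilationDensity (hm : 5 ≤ m) {s : ℕ → ℝ} (hs0 : ∀ k, 0 ≤ s k)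
    (hs1 : ∀ k, s k < 1) (hs : Filter.Tendsto s Filter.atTop (nhds 1)) :
    Filter.Tendsto (fun k => ∫ x, dilationDensity (s k) x ∂(sphereVolume m)) Filter.atTop
      (nhds 0) := by
  have h := tendsto_integral_of_dominated_convergence (μ := sphereVolume m)
    (F := fun k => dilationDensity (s k)) (f := fun _ => 0) _
    (fun k => (measurable_dilationDensity (s k)).aestronglyMeasurable)
    ((integrable_inv_one_sub_coord_sq hm).const_mul 4) (fun k => ?_) ?_
  · simpa using h
  · filter_upwards [ae_one_sub_coord_sq_pos (m := m) (by lia)] with x hx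
    have h := dilationDensity_nonneg_and_le (hs0 k) (hs1 k) hx
    rw [Real.norm_of_nonneg h.1]
    exact h.2
  · filter_upwards [ae_one_sub_coord_sq_pos (m := m) (by lia)] with x hx
    -- The limit denominator is `(2(1 + x₀))³`, nonzero away from the pole `x₀ = -1`, while the
    -- numerator tends to zero.
    have hu : (1 + 2 * (1 * (x : EuclideanSpace ℝ (Fin (m + 1))) 0) + (1 : ℝ) ^ 2) ^ 3 ≠ 0 := by
      refine pow_ne_zero _ (ne_of_gt ?_)
      nlinarith
    have h1 := (((hs.pow 2).const_sub 1).pow 2).div ((((hs.mul_const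
      ((x : EuclideanSpace ℝ (Fin (m + 1))) 0)).const_mul 2).const_add 1).add (hs.pow 2) |>.pow 3) hu
    simp only [one_pow, sub_self, ne_eq, OfNat.ofNat_ne_zero, not_false_eq_true, zero_pow,
      zero_div] at h1
    exact h1

end PolarCaps

/-! ### Homotopy and energy estimate for the dilated maps. -/

section DilationEnergy

variable {m n : ℕ} {N : Type*} [TopologicalSpace N] [ChartedSpace (EuclideanSpace ℝ (Fin n)) N]

theorem dilationFun_zero (x : EuclideanSpace ℝ (Fin (m + 1))) : dilationFun 0 x = x := by
  simp [dilationFun]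

/-- The dilations with parameter `t • a` join the identity at `t = 0` to the given one at `t = 1`.
-/
theorem homotopic_comp_dilation (φ : C^∞⟮𝓡 m, UnitSphere m; 𝓡 n, N⟯)
    {a : EuclideanSpace ℝ (Fin (m + 1))} (ha : ‖a‖ < 1) :
    ContinuousMap.Homotopic ((φ.comp (dilation a ha) : C^∞⟮𝓡 m, UnitSphere m; 𝓡 n, N⟯) :
      C(UnitSphere m, N)) (φ : C(UnitSphere m, N)) := by
  have hb : ∀ t : unitInterval, ‖(t : ℝ) • a‖ < 1 := fun t => by
    rw [norm_smul, Real.norm_of_nonneg t.2.1]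
    exact (mul_le_of_le_one_left (norm_nonneg a) t.2.2).trans_lt ha
  have h1 : Continuous fun z : unitInterval × UnitSphere m =>
      dilationFun ((z.1 : ℝ) • a) (z.2 : EuclideanSpace ℝ (Fin (m + 1))) := by
    have ht : Continuous fun z : unitInterval × UnitSphere m => (z.1 : ℝ) • a := by fun_prop
    have hx : Continuous fun z : unitInterval × UnitSphere m =>
      (z.2 : EuclideanSpace ℝ (Fin (m + 1))) := by fun_prop
    have hi := ht.inner hx (𝕜 := ℝ)
    exact (((continuous_const.add (continuous_const.mul hi)).add (ht.norm.pow 2)).inv₀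
      fun z => (dilation_denom_pos (hb z.1) z.2).ne').smul
      (((continuous_const.sub (ht.norm.pow 2)).smul hx).add
        ((continuous_const.mul (continuous_const.add hi)).smul ht))
  refine ContinuousMap.Homotopic.symm ⟨⟨⟨fun z => φ ⟨dilationFun ((z.1 : ℝ) • a) z.2,
    dilationFun_mem_sphere (hb z.1) z.2⟩, φ.contMDiff.continuous.comp (h1.subtype_mk _)⟩,
    fun x => ?_, fun x => ?_⟩⟩
  · change φ _ = φ x
    congr 1
    ext1
    simp [dilationFun_zero]
  · change φ _ = φ _
    congr 1
    ext1
    simp [coe_dilation]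

/-- The point on the first coordinate axis of the ambient space with coordinate `s`. -/
def axisPoint (m : ℕ) (s : ℝ) : EuclideanSpace ℝ (Fin (m + 1)) :=
  EuclideanSpace.single 0 s

theorem norm_axisPoint_lt_one {s : ℝ} (hs0 : 0 ≤ s) (hs1 : s < 1) : ‖axisPoint m s‖ < 1 := by
  simpa [axisPoint, abs_of_nonneg hs0] using hs1

variable [IsManifold (𝓡 n) ∞ N]

theorem energyDensity_comp_dilation_le (hm : 5 ≤ m) (h : SmoothMetric n N)
    (φ : C^∞⟮𝓡 m, UnitSphere m; 𝓡 n, N⟯) (hφ : IsHarmonicMap (sphereMetric m) h φ) {C : ℝ}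
    (hC : ∀ q, differentialNormSq (sphereMetric m) h φ q ≤ C) {s : ℝ} (hs0 : 0 ≤ s) (hs1 : s < 1)
    (p : UnitSphere m) :
    tensionNormSq (sphereMetric m) h
        (φ.comp (dilation (axisPoint m s) (norm_axisPoint_lt_one hs0 hs1))) p
      + 2 / 3 * (m - 1) * (m - 3) * differentialNormSq (sphereMetric m) h
        (φ.comp (dilation (axisPoint m s) (norm_axisPoint_lt_one hs0 hs1))) p
      ≤ ((2 * m - 4) ^ 2 + 2 / 3 * (m - 1) * (m - 3) * 4) * C * dilationDensity s p := by
  have ha := norm_axisPoint_lt_one (m := m) hs0 hs1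
  set a := axisPoint m s with ha_def
  have hm' : (5 : ℝ) ≤ m := by exact_mod_cast hm
  have hin : inner ℝ a (p : EuclideanSpace ℝ (Fin (m + 1)))
      = s * (p : EuclideanSpace ℝ (Fin (m + 1))) 0 := by
    rw [ha_def, axisPoint, EuclideanSpace.inner_single_left]
    simp
  have hnorm : ‖a‖ ^ 2 = s ^ 2 := by simp [ha_def, axisPoint]
  have hD := dilation_denom_pos ha p
  have hσ : Continuous (dilation a ha) := (dilation a ha).contMDiff.continuous
  have hs := contDiffAt_dilationTransition ha p (dilation a ha p)
  have hs0' := dilationTransition_zero a p (dilation a ha p)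
  have hsσ := writtenInExtChartAt_dilation ha p
  have hL := sum_partialDeriv_dilationTransition ha p
  have ht := sum_sq_laplacian_dilationTransition_le ha p
  have h1 := tensionNormSq_comp_le h φ hφ hσ p hs hs0' hsσ hL
  have h2 := differentialNormSq_comp h φ hσ p hs hs0' hsσ hL
  have hC' := hC (dilation a ha p)
  have hE := differentialNormSq_nonneg h φ (dilation a ha p)
  -- As `‖p + a‖ ≤ 2`, the squared conformal factor, which has only two powers of the denominator,
  -- is also controlled by `dilationDensity`, at the cost of a factor `4`.
  have hD4 : 1 + 2 * inner ℝ a (p : EuclideanSpace ℝ (Fin (m + 1))) + ‖a‖ ^ 2 ≤ 4 := by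
    rw [← norm_add_sphere_sq]
    have := norm_add_le (p : EuclideanSpace ℝ (Fin (m + 1))) a
    rw [norm_eq_of_mem_sphere] at this
    nlinarith [norm_nonneg ((p : EuclideanSpace ℝ (Fin (m + 1))) + a)]
  have hd : dilationDensity s p = (1 - ‖a‖ ^ 2) ^ 2
      / (1 + 2 * inner ℝ a (p : EuclideanSpace ℝ (Fin (m + 1))) + ‖a‖ ^ 2) ^ 3 := by
    rw [dilationDensity, hin, hnorm]
  have hL4 : ((1 - ‖a‖ ^ 2) / (1 + 2 * inner ℝ a (p : EuclideanSpace ℝ (Fin (m + 1)))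
      + ‖a‖ ^ 2)) ^ 2 ≤ 4 * dilationDensity s p := by
    rw [hd]
    generalize 1 + 2 * inner ℝ a (p : EuclideanSpace ℝ (Fin (m + 1))) + ‖a‖ ^ 2 = D at *
    calc _ = D * ((1 - ‖a‖ ^ 2) ^ 2 / D ^ 3) := by field_simp
      _ ≤ _ := by gcongr
  rw [← hd] at ht
  have hd0 : 0 ≤ dilationDensity s p := by rw [hd]; positivity
  have hA : tensionNormSq (sphereMetric m) h (φ ∘ dilation a ha) p
      ≤ (2 * m - 4) ^ 2 * dilationDensity s p * C :=
    h1.trans (mul_le_mul ht hC' hE (by positivity))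
  have hB : differentialNormSq (sphereMetric m) h (φ ∘ dilation a ha) p
      ≤ 4 * dilationDensity s p * C :=
    h2.le.trans (mul_le_mul hL4 hC' hE (by positivity))
  have hcoef : (0 : ℝ) ≤ 2 / 3 * (m - 1) * (m - 3) :=
    mul_nonneg (mul_nonneg (by norm_num) (by linarith)) (by linarith)
  calc _ ≤ (2 * m - 4) ^ 2 * dilationDensity s p * C
        + 2 / 3 * (m - 1) * (m - 3) * (4 * dilationDensity s p * C) :=
        add_le_add hA (mul_le_mul_of_nonneg_left hB hcoef)
    _ = _ := by ring

theorem energyDensity_nonneg (hm : 5 ≤ m) (h : SmoothMetric n N) (ψ : UnitSphere m → N)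
    (p : UnitSphere m) :
    0 ≤ tensionNormSq (sphereMetric m) h ψ p
      + 2 / 3 * (m - 1) * (m - 3) * differentialNormSq (sphereMetric m) h ψ p := by
  have hm' : (5 : ℝ) ≤ m := by exact_mod_cast hm
  have hcoef : (0 : ℝ) ≤ 2 / 3 * (m - 1) * (m - 3) :=
    mul_nonneg (mul_nonneg (by norm_num) (by linarith)) (by linarith)
  exact add_nonneg (tensionNormSq_nonneg h ψ p)
    (mul_nonneg hcoef (differentialNormSq_nonneg h ψ p))

end DilationEnergy

end

/-! ### The infimum is zero. -/

theorem mainTheorem5 (m n : ℕ) (hm : 5 ≤ m)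
    (N : Type*) [TopologicalSpace N] [T2Space N] [SecondCountableTopology N] [ConnectedSpace N]
    [ChartedSpace (EuclideanSpace ℝ (Fin n)) N] [IsManifold (𝓡 n) ∞ N]
    (h : SmoothMetric n N)
    (φ : C^∞⟮𝓡 m, UnitSphere m; 𝓡 n, N⟯) (hφ : IsHarmonicMap (sphereMetric m) h φ) :
    IsGLB
      ((fun ψ : C^∞⟮𝓡 m, UnitSphere m; 𝓡 n, N⟯ =>
          conformalBienergy (sphereMetric m) (sphereVolume m) h ψ) ''
        {ψ | ContinuousMap.Homotopic (ψ : C(UnitSphere m, N)) (φ : C(UnitSphere m, N))})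
      0 := by
  refine ⟨?_, fun b hb => ?_⟩
  · rintro _ ⟨ψ, -, rfl⟩
    simp only [conformalBienergy_sphereMetric]
    exact mul_nonneg (by norm_num) (integral_nonneg fun p => energyDensity_nonneg hm h ψ p)
  · obtain ⟨C, hC⟩ := exists_differentialNormSq_le h φ
    let s : ℕ → ℝ := fun k => 1 - 1 / ((k : ℝ) + 1)
    have hs0 : ∀ k, 0 ≤ s k := fun k => by
      have : 1 / ((k : ℝ) + 1) ≤ 1 := by
        rw [div_le_one (by positivity)]
        linarith [k.cast_nonneg (α := ℝ)]
      exact sub_nonneg.2 this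
    have hs1 : ∀ k, s k < 1 := fun k => sub_lt_self _ (by positivity)
    have hs : Filter.Tendsto s Filter.atTop (nhds 1) := by
      simpa [s] using tendsto_one_div_add_atTop_nhds_zero_nat.const_sub (1 : ℝ)
    have h1 := (tendsto_integral_dilationDensity hm hs0 hs1 hs).const_mul
      (1 / 2 * (((2 * m - 4) ^ 2 + 2 / 3 * (m - 1) * (m - 3) * 4) * C))
    rw [mul_zero] at h1
    -- A lower bound `b` lies below the energy of each dilated map, hence below the vanishing
    -- majorants.
    refine ge_of_tendsto' h1 fun k => ?_
    refine (hb ⟨φ.comp (dilation (axisPoint m (s k)) (norm_axisPoint_lt_one (hs0 k) (hs1 k))),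
      homotopic_comp_dilation φ _, rfl⟩).trans ?_
    simp only [conformalBienergy_sphereMetric]
    -- Only the majorant has to be integrable here, so measurability of the energy density, defined
    -- through point-dependent charts, is never needed.
    have h2 := integral_mono_of_nonneg (μ := sphereVolume m)
      (Filter.Eventually.of_forall fun p => energyDensity_nonneg hm h _ p)
      ((integrable_dilationDensity hm (hs0 k) (hs1 k)).const_mul _)
      (Filter.Eventually.of_forall fun p =>
        energyDensity_comp_dilation_le hm h φ hφ hC (hs0 k) (hs1 k) p)
    rw [integral_const_mul] at h2
    rw [mul_assoc (1 / 2 : ℝ)]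
    exact mul_le_mul_of_nonneg_left h2 (by norm_num)
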